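/- **Setting.** Let $\mathbb{C}^{+},\mathbb{C}^{-},\mathbb{H}^{+}$ be the open upper, lower and right half-planes, and for $\lambda,M>0$ let $\Gamma_{\lambda,M}:=\{z\in\mathbb{C}^+:\ \operatorname{Im}z>M,\ |\operatorname{Re}z|<\lambda\operatorname{Im}z\}$. For a Borel probability measure $\mu$ on $\mathbb{R}$ let $G_\mu(z)=\int_{\mathbb{R}}\frac{1}{z-x}\,\mu(dx)$ and $F_\mu(z)=1/G_\mu(z)$ for $z\in\mathbb{C}^+$. An analytic function $f$ on an open set $U$ is said to extend $F_\mu$ if $f=F_\mu$ on $U\cap\mathbb{C}^+$; "univalent" means analytic and injective. A right inverse $F_\mu^{-1}$ on a cone $\Gamma_{\lambda,M}$ is a map from $\Gamma_{\lambda,M}$ into some cone $\Gamma_{\lambda',M'}$ on which $F_\mu$ is injective, such that $F_\mu\circ F_\mu^{-1}=\mathrm{id}$ on $\Gamma_{\lambda,M}$. * $\mu$ is in the class $\mathcal{UI}$ if $F_\mu$ has a right inverse $F_\mu^{-1}$ on some cone $\Gamma_{\lambda,M}$ which extends to a univalent map on $\mathbb{C}^+$. * A symmetric $\mu$ is in the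 class $\mathcal{UI}_s$ if (a) there are a real $c\le 0$ and a univalent map $f$ on an open neighbourhood of $i(c,\infty)$ that extends $F_\mu$ and maps $i(c,\infty)$ onto $i(0,\infty)$; and (b) there is an open set $\widetilde\Omega\subset\mathbb{C}^-\cup\mathbb{H}^+$ that meets every cone $\Gamma_{\lambda,M}$ ($\lambda,M>0$), and an analytic function on $\widetilde\Omega$ that extends $F_\mu$ and maps $\widetilde\Omega$ bijectively onto $\mathbb{C}^+\cap\mathbb{H}^+$. For $q>\frac12$ let $\mathbf{t}_q$ be the Student t-distribution $$\mathbf{t}_q(dx)=\frac{1}{B(\frac12,q-\frac12)}\,\frac{1}{(1+x^2)^q}\,dx\quad\text{on }\mathbb{R},$$ where $B$ is the beta function. **Theorem.** (1) $\mathbf{t}_q\in\mathcal{UI}$ for every real $q\in\left(\tfrac12,2\right]\cup\bigcup_{n=1}^\infty\left[2n+\tfrac12,\,2n+2\right]$. (2) $\mathbf{t}_q\in\mathcal{UI}_s$ for every real $q\in\left(\tfrac12,1\right]\cup\bigcup_{n=1}^\infty\left[n+\tfrac14,\,n+1\right]$. -/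

import Mathlib

open MeasureTheory Set

namespace FreeUI

/-- The open upper half-plane `ℂ⁺`. -/
def upper : Set ℂ := {z | 0 < z.im}

/-- The open lower half-plane `ℂ⁻`. -/
def lower : Set ℂ := {z | z.im < 0}

/-- The open right half-plane `ℍ⁺`. -/
def right : Set ℂ := {z | 0 < z.re}

/-- The truncated cone `Γ_{l,M} = {z ∈ ℂ⁺ : Im z > M, |Re z| < l * Im z}`. -/
def cone (l M : ℝ) : Set ℂ := {z | z ∈ upper ∧ M < z.im ∧ |z.re| < l * z.im}

/-- The segment or half-line `i(c, ∞)` of the imaginary axis. -/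
def imagAxis (c : ℝ) : Set ℂ := {z | ∃ y : ℝ, c < y ∧ z = (y : ℂ) * Complex.I}

/-- The Cauchy transform `G_μ(z) = ∫ 1 / (z - x) μ(dx)`; it is used for `z ∈ ℂ⁺` only. -/
noncomputable def cauchyTransform (μ : Measure ℝ) (z : ℂ) : ℂ :=
  ∫ x : ℝ, 1 / (z - (x : ℂ)) ∂μ

/-- The reciprocal Cauchy transform `F_μ = 1 / G_μ`; it is used on `ℂ⁺` only. -/
noncomputable def recipCauchy (μ : Measure ℝ) (z : ℂ) : ℂ :=
  1 / cauchyTransform μ z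

/-- A univalent map on an open set: analytic and injective. -/
def Univalent (f : ℂ → ℂ) (U : Set ℂ) : Prop :=
  DifferentiableOn ℂ f U ∧ InjOn f U

/-- `f` on the open set `U` is an extension of `F_μ`: it agrees with `F_μ` on the part of `U` in
`ℂ⁺`, where `F_μ` is defined. -/
def ExtendsRecipCauchy (μ : Measure ℝ) (f : ℂ → ℂ) (U : Set ℂ) : Prop :=
  EqOn f (recipCauchy μ) (U ∩ upper)

/-- `g` is the right compositional inverse `F_μ⁻¹` on the cone `Γ_{l,M}`, that is, the inverse of
the restriction of `F_μ` to some cone `Γ_{l',M'}` on which `F_μ` is injective. (The requirement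
that the values lie in such a cone selects the branch near infinity: `F_μ` need not be injective
on all of `ℂ⁺`.) -/
def IsRightInverseOn (μ : Measure ℝ) (l M : ℝ) (g : ℂ → ℂ) : Prop :=
  ∃ l' M' : ℝ, 0 < l' ∧ 0 < M' ∧ InjOn (recipCauchy μ) (cone l' M') ∧
    ∀ z ∈ cone l M, g z ∈ cone l' M' ∧ recipCauchy μ (g z) = z

/-- The class `𝒰ℐ`: probability measures for which `F_μ⁻¹`, defined on some `Γ_{l,M}`, extends
analytically to a univalent map in `ℂ⁺`. -/
def ClassUI (μ : Measure ℝ) : Prop :=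
  IsProbabilityMeasure μ ∧
    ∃ l M : ℝ, 0 < l ∧ 0 < M ∧ ∃ g : ℂ → ℂ, IsRightInverseOn μ l M g ∧ Univalent g upper

/-- The class `𝒰ℐ_s` of symmetric probability measures. In the second clause the domain `Ω` is
required to meet every truncated cone, so in particular the ones on which `F_μ⁻¹` is defined. -/
def ClassUIs (μ : Measure ℝ) : Prop :=
  IsProbabilityMeasure μ ∧ μ.IsNegInvariant ∧
    (∃ c : ℝ, c ≤ 0 ∧ ∃ (U : Set ℂ) (f : ℂ → ℂ), IsOpen U ∧ imagAxis c ⊆ U ∧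
      Univalent f U ∧ ExtendsRecipCauchy μ f U ∧ f '' imagAxis c = imagAxis 0) ∧
    (∃ (Ω : Set ℂ) (f : ℂ → ℂ), IsOpen Ω ∧ Ω ⊆ lower ∪ right ∧
      (∀ l M : ℝ, 0 < l → 0 < M → (Ω ∩ cone l M).Nonempty) ∧
      DifferentiableOn ℂ f Ω ∧ ExtendsRecipCauchy μ f Ω ∧ BijOn f Ω (upper ∩ right))

/-- The Student t-distribution `t_q(dx) = (1 / B(1/2, q - 1/2)) (1 + x²)^(-q) dx`, for
`q > 1/2`. -/
noncomputable def studentT (q : ℝ) : Measure ℝ :=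
  volume.withDensity fun x : ℝ =>
    ENNReal.ofReal (1 / ProbabilityTheory.beta (1 / 2) (q - 1 / 2) * (1 / (1 + x ^ 2) ^ q))

end FreeUI

/-! The argument is uniform in q > 1/2. In the coordinate p = 1 - iz, let S = `studentCont q` be i
times the Cauchy transform of t_q, so that F = i/S and z in the upper half-plane means Re p > 1.
Integration by parts shows that S solves p(2-p)S' = 2q(p-1)S - (2q-1). Variation of constants from p
= 2 gives the solution that is regular there, the integral `eulerInt` up to a factor; it is
holomorphic on the whole slit plane and so continues the transform.

The equation is compatible with p ↦ 2-p, which gives the reflection formula S(p) + S(2-p) = A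
(p(2-p))^(-q) with A > 0 (`exists_studentCont_reflection`). Let `studentDom` be the half-plane Re p
> 1 together with the points where q|arg p + arg(2-p)| < π/2. On its boundary inside the slit plane
the right side of the formula is purely imaginary, while Re S(2-p) > 0, so Re S(p) < 0. At infinity
S tends to 0, at p = 0 it blows up, and the cut is not reached because qπ > π/2. Hence S is a proper
map from `studentReg`, the part of `studentDom` with Re S > 0, to the right half-plane
(`studentCont_proper`).

A proper holomorphic map has constant degree, and the degree is 1 because a large positive value has
a single, simple preimage (`exists_simple_fibre_studentCont`). So S is biholomorphic from
`studentReg` onto the right half-plane (`bijOn_studentCont`), and F continues to a conformal map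
onto the upper half-plane. Its inverse is the univalent extension required for `ClassUI`. Since S
commutes with conjugation, it preserves the real axis and matches up the quadrants, which gives
`ClassUIs`. -/

namespace FreeUI
open Filter Topology

/-! ### Proper holomorphic maps of degree one -/

/-- Near a critical point, a non-constant analytic function takes every nearby value twice. -/
theorem exists_two_preimages_of_deriv_eq_zero {f : ℂ → ℂ} {z₀ : ℂ} (hf : AnalyticAt ℂ f z₀)
    (hd : deriv f z₀ = 0) (hc : ¬ ∀ᶠ z in 𝓝 z₀, f z = f z₀) {N : Set ℂ} (hN : N ∈ 𝓝 z₀) :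
    ∀ᶠ w in 𝓝 (f z₀), w ≠ f z₀ → ∃ z₁ ∈ N, ∃ z₂ ∈ N, z₁ ≠ z₂ ∧ f z₁ = w ∧ f z₂ = w := by
  have hF : AnalyticAt ℂ (fun z => f z - f z₀) z₀ := hf.sub analyticAt_const
  obtain ⟨n, g, hg, hg0, hfg⟩ := hF.exists_eventuallyEq_pow_smul_nonzero_iff.2 (by
    intro h; exact hc (h.mono fun z hz => sub_eq_zero.1 hz))
  have hn0 : n ≠ 0 := by
    rintro rfl
    have := hfg.self_of_nhds
    simp at this
    exact hg0 this.symm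
  have hn1 : n ≠ 1 := by
    rintro rfl
    have h1 : HasDerivAt (fun z => (z - z₀) ^ 1 • g z) (g z₀) z₀ := by
      have := ((hasDerivAt_id z₀).sub_const z₀).fun_mul hg.differentiableAt.hasDerivAt
      simpa using this
    have h2 : HasDerivAt (fun z => f z - f z₀) (g z₀) z₀ := h1.congr_of_eventuallyEq hfg
    have h3 := h2.deriv
    rw [deriv_sub_const, hd] at h3
    exact hg0 h3.symm
  set c := g z₀ with hcdef
  -- A holomorphic n-th root of g. Dividing by c first puts the base at 1 when z = z₀, away from the
  -- cut of the power.
  set r : ℂ → ℂ := fun z => (g z / c) ^ ((n : ℂ)⁻¹) * c ^ ((n : ℂ)⁻¹) with hr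
  have hra : AnalyticAt ℂ r z₀ := by
    refine AnalyticAt.mul ?_ analyticAt_const
    refine (hg.div analyticAt_const hg0).cpow analyticAt_const ?_
    simp [← hcdef, hg0]
  have hrn : ∀ z, r z ^ n = g z := by
    intro z
    rw [hr]
    simp only [mul_pow, Complex.cpow_nat_inv_pow _ hn0]
    field_simp
  have hr0 : r z₀ ≠ 0 := by
    intro h
    have := hrn z₀
    rw [h, zero_pow hn0] at this
    exact hg0 this.symm
  -- The n-th power of this local coordinate is f - f z₀, so preimages of w correspond to n-th roots
  -- of w - f z₀. As n ≥ 2, two distinct roots are available: the principal one and its product with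
  -- ζ.
  have hh : HasStrictDerivAt (fun z => (z - z₀) * r z) (r z₀) z₀ := by
    have h1 : HasStrictDerivAt (fun z => z - z₀) 1 z₀ := (hasStrictDerivAt_id z₀).sub_const z₀
    have := h1.fun_mul hra.hasStrictDerivAt
    simpa using this
  have hmap := hh.map_nhds_eq hr0
  simp only [sub_self, zero_mul] at hmap
  set N' := N ∩ {z | f z - f z₀ = (z - z₀) ^ n • g z} with hN'
  have hN'm : N' ∈ 𝓝 z₀ := inter_mem hN hfg
  have him : (fun z => (z - z₀) * r z) '' N' ∈ 𝓝 (0 : ℂ) := by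
    rw [← hmap]; exact image_mem_map hN'm
  set ζ : ℂ := Complex.exp (2 * Real.pi * Complex.I / n) with hζ
  have hprim : IsPrimitiveRoot ζ n := Complex.isPrimitiveRoot_exp n hn0
  have hζ1 : ζ ≠ 1 := hprim.ne_one (by omega)
  have hcont : Tendsto (fun w : ℂ => (w - f z₀) ^ ((n : ℂ)⁻¹)) (𝓝 (f z₀)) (𝓝 0) := by
    have h1 : ContinuousAt (fun v : ℂ => v ^ ((n : ℂ)⁻¹)) 0 := by
      have := Complex.continuousAt_cpow_zero_of_re_pos (z := ((n : ℂ)⁻¹)) (by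
        rw [← Complex.ofReal_natCast, ← Complex.ofReal_inv, Complex.ofReal_re]; positivity)
      exact this.comp (f := fun v : ℂ => (v, ((n : ℂ)⁻¹))) (by fun_prop)
    have h2 : Tendsto (fun w : ℂ => w - f z₀) (𝓝 (f z₀)) (𝓝 0) := by
      have : Continuous (fun w : ℂ => w - f z₀) := by fun_prop
      simpa using this.tendsto (f z₀)
    have h3 := h1.tendsto.comp h2
    rw [Complex.zero_cpow (by simp [hn0])] at h3
    exact h3
  have hcont2 : Tendsto (fun w : ℂ => ζ * (w - f z₀) ^ ((n : ℂ)⁻¹)) (𝓝 (f z₀)) (𝓝 0) := by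
    simpa using hcont.const_mul ζ
  filter_upwards [hcont him, hcont2 him] with w h1 h2 hw
  obtain ⟨z₁, hz₁, e₁⟩ := h1
  obtain ⟨z₂, hz₂, e₂⟩ := h2
  simp only at e₁ e₂
  have key : ∀ z ∈ N', ((z - z₀) * r z) ^ n = f z - f z₀ := by
    intro z hz
    have h := hz.2
    simp only [mem_ofPred_eq, smul_eq_mul] at h
    rw [mul_pow, hrn, h]
  have hv : ((w - f z₀) ^ ((n : ℂ)⁻¹)) ^ n = w - f z₀ := Complex.cpow_nat_inv_pow _ hn0
  refine ⟨z₁, hz₁.1, z₂, hz₂.1, ?_, ?_, ?_⟩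
  · rintro rfl
    rw [e₁] at e₂
    have hv0 : (w - f z₀) ^ ((n : ℂ)⁻¹) ≠ 0 := by
      intro h
      rw [h, zero_pow hn0] at hv
      exact hw (sub_eq_zero.1 hv.symm)
    apply hζ1
    have := mul_right_cancel₀ hv0 (e₂.symm.trans (one_mul _).symm)
    exact this
  · have := key z₁ hz₁
    rw [e₁, hv] at this
    linear_combination -this
  · have := key z₂ hz₂
    rw [e₂, mul_pow, hprim.pow_eq_one, hv, one_mul] at this
    linear_combination -this

/-- A proper non-constant holomorphic map onto a connected open set which has a simple fibre
is biholomorphic. -/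
theorem bijOn_of_proper {f : ℂ → ℂ} {E V : Set ℂ} (hE : IsOpen E)
    (hVc : IsPreconnected V) (hf : DifferentiableOn ℂ f E) (hmaps : MapsTo f E V)
    (hconst : ∀ z ∈ E, ¬ ∀ᶠ z' in 𝓝 z, f z' = f z)
    (hproper : ∀ w ∈ V, ∀ u : ℕ → ℂ, (∀ n, u n ∈ E) → Tendsto (f ∘ u) atTop (𝓝 w) →
      ∃ z ∈ E, ∃ φ : ℕ → ℕ, StrictMono φ ∧ Tendsto (u ∘ φ) atTop (𝓝 z))
    {z₀ : ℂ} (hz₀ : z₀ ∈ E) (hd₀ : deriv f z₀ ≠ 0) (huniq : ∀ z ∈ E, f z = f z₀ → z = z₀) :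
    BijOn f E V ∧ ∀ z ∈ E, deriv f z ≠ 0 := by
  have han : ∀ z ∈ E, AnalyticAt ℂ f z := fun z hz => hf.analyticAt (hE.mem_nhds hz)
  have hopen : ∀ z ∈ E, 𝓝 (f z) ≤ map f (𝓝 z) := fun z hz =>
    (han z hz).eventually_constant_or_nhds_le_map_nhds.resolve_left (hconst z hz)
  -- The values with exactly one preimage, and that one simple. This set is shown to be open and
  -- relatively closed in V.
  set S : Set ℂ := {w | ∃ z ∈ E, f z = w ∧ deriv f z ≠ 0 ∧ ∀ z' ∈ E, f z' = w → z' = z} with hS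
  have hSopen : IsOpen S := by
    rw [isOpen_iff_mem_nhds]
    rintro w ⟨z, hz, rfl, hd, hu⟩
    have hsd : HasStrictDerivAt f (deriv f z) z := (han z hz).hasStrictDerivAt
    obtain ⟨N, hN, hNinj⟩ : ∃ N ∈ 𝓝 z, InjOn f N := by
      have hl := (hsd.hasStrictFDerivAt_equiv hd).eventually_left_inverse
      exact ⟨_, hl, fun a ha b hb hab => by
        rw [← (ha : _ = a), ← (hb : _ = b), hab]⟩
    have hdc : ∀ᶠ z' in 𝓝 z, deriv f z' ≠ 0 :=
      (han z hz).deriv.continuousAt.eventually_ne hd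
    set N' := N ∩ E ∩ {z' | deriv f z' ≠ 0} with hN'
    have hN'm : N' ∈ 𝓝 z := inter_mem (inter_mem hN (hE.mem_nhds hz)) hdc
    -- Properness: preimages of values tending to f z accumulate only at preimages of f z, that is,
    -- at z. So nearby fibres lie in N', where f is injective and has no critical point.
    have hev : ∀ᶠ w in 𝓝 (f z), ∀ z' ∈ E, f z' = w → z' ∈ N' := by
      by_contra hcon
      obtain ⟨v, hv, hv2⟩ := Filter.exists_seq_forall_of_frequently (not_eventually.1 hcon)
      push Not at hv2
      choose u hu1 hu2 hu3 using hv2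
      have : Tendsto (f ∘ u) atTop (𝓝 (f z)) := by
        have e : f ∘ u = v := funext hu2
        rw [e]; exact hv
      obtain ⟨y, hy, φ, hφ, hlim⟩ := hproper _ (hmaps hz) u hu1 this
      have h1 : Tendsto (f ∘ u ∘ φ) atTop (𝓝 (f y)) :=
        (han y hy).continuousAt.tendsto.comp hlim
      have h2 : Tendsto (f ∘ u ∘ φ) atTop (𝓝 (f z)) := this.comp hφ.tendsto_atTop
      have hyz : y = z := hu y hy (tendsto_nhds_unique h1 h2)
      subst hyz
      obtain ⟨n, hn⟩ := (hlim.eventually hN'm).exists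
      exact hu3 _ hn
    filter_upwards [hev, hopen z hz (image_mem_map hN'm)] with w h1 h2
    obtain ⟨z', hz', rfl⟩ := h2
    exact ⟨z', hz'.1.2, rfl, hz'.2, fun z'' hz'' e => hNinj (h1 z'' hz'' e).1.1 hz'.1.1 e⟩
  have hScl : ∀ w ∈ V, w ∈ closure S → w ∈ S := by
    intro w hw hwc
    by_contra hwS
    obtain ⟨v, hv, hvw⟩ := mem_closure_iff_seq_limit.1 hwc
    choose u hu1 hu2 _ _ using hv
    obtain ⟨z, hz, φ, hφ, hlim⟩ := hproper w hw u hu1 (by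
      rw [show f ∘ u = v from funext hu2]; exact hvw)
    have hfz : f z = w := by
      refine tendsto_nhds_unique ((han z hz).continuousAt.tendsto.comp hlim) ?_
      have := hvw.comp hφ.tendsto_atTop
      rwa [show v ∘ φ = f ∘ u ∘ φ from funext fun n => (hu2 _).symm] at this
    have hfreq : ∃ᶠ w' in 𝓝 w, w' ∈ S := mem_closure_iff_frequently.1 hwc
    -- By openness of f, two distinct preimages of w would give two preimages of every nearby value,
    -- but values of S accumulate at w.
    have huq : ∀ z' ∈ E, f z' = w → z' = z := by
      intro z' hz' e
      by_contra hne
      obtain ⟨A, B, hA, hB, hzA, hzB, hdis⟩ := t2_separation hne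
      have h1 := hopen z' hz' (image_mem_map (inter_mem (hE.mem_nhds hz') (hA.mem_nhds hzA)))
      have h2 := hopen z hz (image_mem_map (inter_mem (hE.mem_nhds hz) (hB.mem_nhds hzB)))
      rw [e] at h1
      rw [hfz] at h2
      obtain ⟨w', ⟨y, hy, hyw, _, hyu⟩, ⟨a, ha, ea⟩, ⟨b, hb, eb⟩⟩ :=
        (hfreq.and_eventually (Filter.Eventually.and h1 h2)).exists
      have e1 := hyu a ha.1 ea
      have e2 := hyu b hb.1 eb
      exact hdis.ne_of_mem ha.2 hb.2 (e1.trans e2.symm)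
    by_cases hd : deriv f z = 0
    · have := exists_two_preimages_of_deriv_eq_zero (han z hz) hd (hconst z hz) (hE.mem_nhds hz)
      rw [hfz] at this
      obtain ⟨w', hw', h⟩ := (hfreq.and_eventually this).exists
      obtain ⟨z₁, h1, z₂, h2, hne, e1, e2⟩ := h (by rintro rfl; exact hwS hw')
      obtain ⟨y, hy, hyw, _, hyu⟩ := hw'
      exact hne ((hyu z₁ h1 e1).trans (hyu z₂ h2 e2).symm)
    · exact hwS ⟨z, hz, hfz, hd, huq⟩
  have hVS : V ⊆ S := by
    refine hVc.subset_of_closure_inter_subset hSopen ⟨f z₀, hmaps hz₀, z₀, hz₀, rfl, hd₀, huniq⟩ ?_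
    rintro w ⟨h1, h2⟩
    exact hScl w h2 h1
  refine ⟨⟨hmaps, ?_, ?_⟩, ?_⟩
  · intro a ha b hb hab
    obtain ⟨z, _, _, _, hu⟩ := hVS (hmaps ha)
    exact (hu a ha rfl).trans (hu b hb hab.symm).symm
  · intro w hw
    obtain ⟨z, hz, e, _⟩ := hVS hw
    exact ⟨z, hz, e⟩
  · intro z hz
    obtain ⟨z', hz', _, hd, hu⟩ := hVS (hmaps hz)
    rwa [hu z hz rfl]

/-- The inverse of a biholomorphic map is holomorphic. -/
theorem differentiableOn_of_rightInvOn {f g : ℂ → ℂ} {E V : Set ℂ} (hE : IsOpen E)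
    (hf : DifferentiableOn ℂ f E) (hinj : InjOn f E) (hd : ∀ z ∈ E, deriv f z ≠ 0)
    (hgE : MapsTo g V E) (hfg : ∀ w ∈ V, f (g w) = w) (hVo : IsOpen V) :
    DifferentiableOn ℂ g V := by
  intro w hw
  have hz := hgE hw
  have han : AnalyticAt ℂ f (g w) := hf.analyticAt (hE.mem_nhds hz)
  have hmap : map f (𝓝 (g w)) = 𝓝 w := by
    rw [han.hasStrictDerivAt.map_nhds_eq (hd _ hz), hfg w hw]
  have hcont : ContinuousAt g w := by
    intro N hN
    have h1 : f '' (N ∩ E) ∈ 𝓝 w := by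
      rw [← hmap]; exact image_mem_map (inter_mem hN (hE.mem_nhds hz))
    show ∀ᶠ w' in 𝓝 w, g w' ∈ N
    filter_upwards [h1, hVo.mem_nhds hw] with w' h hw'
    obtain ⟨a, ha, e⟩ := h
    have : a = g w' := hinj ha.2 (hgE hw') (by rw [e, hfg w' hw'])
    rw [← this]
    exact ha.1
  have hev : ∀ᶠ w' in 𝓝 w, f (g w') = w' := by
    filter_upwards [hVo.mem_nhds hw] with w' hw'
    exact hfg w' hw'
  exact (HasDerivAt.of_local_left_inverse hcont han.differentiableAt.hasDerivAt (hd _ hz)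
    hev).differentiableAt.differentiableWithinAt

end FreeUI

/-! ### The Student law is a symmetric probability measure -/

namespace FreeUI
open Filter Topology

/-- Write Γ(q)(1+x²)^(-q) as the integral of t^(q-1) exp(-(1+x²)t) over t > 0, exchange the
integrals by Tonelli, and evaluate the Gaussian integral in x. What remains is √π Γ(q-1/2). -/
theorem lintegral_one_add_sq_rpow {q : ℝ} (hq : 1 / 2 < q) :
    ∫⁻ x : ℝ, ENNReal.ofReal (1 / (1 + x ^ 2) ^ q) =
      ENNReal.ofReal (ProbabilityTheory.beta (1 / 2) (q - 1 / 2)) := by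
  have hq0 : 0 < q := by linarith
  have hG : 0 < Real.Gamma q := Real.Gamma_pos_of_pos hq0
  have hgam : ∀ a r : ℝ, 0 < a → 0 < r →
      ∫⁻ t in Ioi (0 : ℝ), ENNReal.ofReal (t ^ (a - 1) * Real.exp (-(r * t))) =
        ENNReal.ofReal ((1 / r) ^ a * Real.Gamma a) := by
    intro a r ha hr
    rw [← Real.integral_rpow_mul_exp_neg_mul_Ioi ha hr]
    refine (ofReal_integral_eq_lintegral_ofReal ?_ ?_).symm
    · have := Real.integral_rpow_mul_exp_neg_mul_Ioi ha hr
      -- A non-integrable function has integral 0 by convention, which contradicts the positive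
      -- value.
      by_contra hcon
      rw [integral_undef hcon] at this
      have h2 : 0 < (1 / r) ^ a * Real.Gamma a :=
        mul_pos (Real.rpow_pos_of_pos (by positivity) _) (Real.Gamma_pos_of_pos ha)
      exact h2.ne this
    · refine (ae_restrict_iff' measurableSet_Ioi).2 (Eventually.of_forall fun t ht => ?_)
      have : (0 : ℝ) < t := ht
      simp only [Pi.zero_apply]
      positivity
  have h1 : ∀ x : ℝ, ENNReal.ofReal (Real.Gamma q) * ENNReal.ofReal (1 / (1 + x ^ 2) ^ q) =
      ∫⁻ t in Ioi (0 : ℝ), ENNReal.ofReal (t ^ (q - 1) * Real.exp (-((1 + x ^ 2) * t))) := by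
    intro x
    rw [hgam q (1 + x ^ 2) hq0 (by positivity), ← ENNReal.ofReal_mul hG.le,
      Real.div_rpow zero_le_one (by positivity), Real.one_rpow, mul_comm]
  have h2 : ∀ t ∈ Ioi (0 : ℝ),
      ∫⁻ x : ℝ, ENNReal.ofReal (t ^ (q - 1) * Real.exp (-((1 + x ^ 2) * t))) =
      ENNReal.ofReal (Real.sqrt Real.pi) *
        ENNReal.ofReal (t ^ (q - 1 / 2 - 1) * Real.exp (-(1 * t))) := by
    intro t ht
    have ht0 : (0 : ℝ) < t := ht
    have e : ∀ x : ℝ, t ^ (q - 1) * Real.exp (-((1 + x ^ 2) * t)) =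
        (t ^ (q - 1) * Real.exp (-t)) * Real.exp (-t * x ^ 2) := by
      intro x
      rw [mul_assoc, ← Real.exp_add]
      ring_nf
    rw [← ENNReal.ofReal_mul (Real.sqrt_nonneg _)]
    rw [← ofReal_integral_eq_lintegral_ofReal]
    · congr 1
      simp_rw [e]
      rw [integral_const_mul, integral_gaussian, Real.sqrt_div Real.pi_pos.le,
        show q - 1 / 2 - 1 = (q - 1) - 1 / 2 by ring, Real.rpow_sub ht0 (q - 1) (1 / 2),
        ← Real.sqrt_eq_rpow, one_mul]
      ring
    · simp_rw [e]
      exact (integrable_exp_neg_mul_sq ht0).const_mul _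
    · exact Eventually.of_forall fun x => by
        simp only [Pi.zero_apply]; positivity
  have h3 : ENNReal.ofReal (Real.Gamma q) * ∫⁻ x : ℝ, ENNReal.ofReal (1 / (1 + x ^ 2) ^ q) =
      ENNReal.ofReal (Real.sqrt Real.pi * Real.Gamma (q - 1 / 2)) := by
    rw [← lintegral_const_mul' _ _ ENNReal.ofReal_ne_top]
    simp_rw [h1]
    rw [lintegral_lintegral_swap (by fun_prop)]
    rw [setLIntegral_congr_fun measurableSet_Ioi h2,
      lintegral_const_mul' _ _ ENNReal.ofReal_ne_top, hgam _ _ (by linarith) one_pos,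
      ← ENNReal.ofReal_mul (Real.sqrt_nonneg _)]
    simp
  have h4 : Real.sqrt Real.pi * Real.Gamma (q - 1 / 2) =
      Real.Gamma q * ProbabilityTheory.beta (1 / 2) (q - 1 / 2) := by
    rw [ProbabilityTheory.beta, Real.Gamma_one_half_eq, show 1 / 2 + (q - 1 / 2) = q by ring]
    field_simp
  rw [h4, ENNReal.ofReal_mul hG.le] at h3
  exact (ENNReal.mul_right_inj (by simpa using hG) ENNReal.ofReal_ne_top).1 h3

/-- The Student density. -/
noncomputable def studentPDF (q x : ℝ) : ℝ :=
  1 / ProbabilityTheory.beta (1 / 2) (q - 1 / 2) * (1 / (1 + x ^ 2) ^ q)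

theorem studentPDF_pos {q : ℝ} (hq : 1 / 2 < q) (x : ℝ) : 0 < studentPDF q x := by
  have := ProbabilityTheory.beta_pos (α := 1 / 2) (β := q - 1 / 2) (by norm_num) (by linarith)
  unfold studentPDF
  positivity

theorem continuous_studentPDF (q : ℝ) : Continuous (studentPDF q) := by
  unfold studentPDF
  refine continuous_const.mul (continuous_const.div ?_ fun x => by positivity)
  exact Continuous.rpow_const (by fun_prop) fun x => Or.inl (by positivity)

theorem studentT_eq (q : ℝ) :
    studentT q = volume.withDensity fun x => ENNReal.ofReal (studentPDF q x) := rfl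

theorem isProbabilityMeasure_studentT {q : ℝ} (hq : 1 / 2 < q) :
    IsProbabilityMeasure (studentT q) := by
  have hB := ProbabilityTheory.beta_pos (α := 1 / 2) (β := q - 1 / 2) (by norm_num) (by linarith)
  refine ⟨?_⟩
  rw [studentT, withDensity_apply _ MeasurableSet.univ, Measure.restrict_univ]
  simp_rw [ENNReal.ofReal_mul (one_div_pos.2 hB).le]
  rw [lintegral_const_mul' _ _ ENNReal.ofReal_ne_top, lintegral_one_add_sq_rpow hq,
    ← ENNReal.ofReal_mul (one_div_pos.2 hB).le, one_div_mul_cancel hB.ne', ENNReal.ofReal_one]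

theorem isNegInvariant_studentT (q : ℝ) : (studentT q).IsNegInvariant := by
  refine ⟨?_⟩
  ext s hs
  rw [Measure.neg_def, Measure.map_apply measurable_neg hs, studentT_eq,
    withDensity_apply _ (measurable_neg hs), withDensity_apply _ hs,
    ← lintegral_indicator (measurable_neg hs), ← lintegral_indicator hs,
    ← lintegral_neg_eq_self]
  refine lintegral_congr fun x => ?_
  by_cases hx : x ∈ s <;> simp [indicator, hx, studentPDF]

theorem integral_studentT {q : ℝ} (hq : 1 / 2 < q) (f : ℝ → ℂ) :
    ∫ x, f x ∂(studentT q) = ∫ x, (studentPDF q x : ℂ) * f x := by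
  rw [studentT_eq, integral_withDensity_eq_integral_toReal_smul
    (by have := (continuous_studentPDF q).measurable; fun_prop) (by simp)]
  refine integral_congr_ae (Eventually.of_forall fun x => ?_)
  simp [ENNReal.toReal_ofReal (studentPDF_pos hq x).le]

theorem integral_studentPDF {q : ℝ} (hq : 1 / 2 < q) :
    ∫ x, (studentPDF q x : ℂ) = 1 := by
  have := isProbabilityMeasure_studentT hq
  have h := integral_studentT hq (fun _ => 1)
  simpa using h.symm

theorem integrable_studentPDF {q : ℝ} (hq : 1 / 2 < q) :
    Integrable (fun x => (studentPDF q x : ℂ)) := by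
  by_contra h
  have := integral_studentPDF hq
  rw [integral_undef h] at this
  exact zero_ne_one this

end FreeUI

/-! ### The continued transform on the slit plane -/

namespace FreeUI
open Filter Topology Complex

/-- The slit plane is star-shaped about 2, so the power in `eulerInt` never meets its cut. -/
theorem convexComb_mem_slitPlane {p : ℂ} (hp : p ∈ slitPlane) {s : ℝ} (hs : s ∈ Icc (0 : ℝ) 1) :
    2 * (1 - (s : ℂ)) + s * p ∈ slitPlane := by
  rcases eq_or_lt_of_le hs.1 with h | h
  · subst h; simp
  · rw [mem_slitPlane_iff] at hp ⊢
    simp only [add_re, mul_re, sub_re, one_re, ofReal_re, re_ofNat, im_ofNat, sub_im, one_im,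
      ofReal_im, add_im, mul_im]
    have h1 := hs.2
    rcases hp with hp | hp
    · left
      have := mul_pos h hp
      nlinarith
    · right
      have : s * p.im ≠ 0 := mul_ne_zero h.ne' hp
      simpa using this

/-- The integral `∫₀¹ s^(q-1) (2(1-s) + sp)^(q-1) ds`. -/
noncomputable def eulerInt (q : ℝ) (p : ℂ) : ℂ :=
  ∫ s in (0 : ℝ)..1, ((s ^ (q - 1) : ℝ) : ℂ) * (2 * (1 - (s : ℂ)) + s * p) ^ ((q : ℂ) - 1)

theorem intervalIntegrable_rpow_mul {a : ℝ} (ha : -1 < a) {f : ℝ → ℂ}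
    (hf : ContinuousOn f (Icc 0 1)) :
    IntervalIntegrable (fun s : ℝ => ((s ^ a : ℝ) : ℂ) * f s) volume 0 1 := by
  have h : IntervalIntegrable (fun s : ℝ => ((s ^ a : ℝ) : ℂ)) volume 0 1 := by
    have := intervalIntegral.intervalIntegrable_rpow' (a := 0) (b := 1) ha
    exact ⟨this.1.ofReal, this.2.ofReal⟩
  exact h.mul_continuousOn (by rwa [uIcc_of_le zero_le_one])

theorem continuousOn_convexComb_cpow {p : ℂ} (hp : p ∈ slitPlane) (a : ℂ) :
    ContinuousOn (fun s : ℝ => (2 * (1 - (s : ℂ)) + s * p) ^ a) (Icc 0 1) := by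
  refine ContinuousOn.cpow_const ?_ fun s hs => convexComb_mem_slitPlane hp hs
  fun_prop

theorem hasDerivAt_eulerInt {q : ℝ} (hq : 0 < q) {p : ℂ} (hp : p ∈ slitPlane) :
    HasDerivAt (eulerInt q) (∫ s in (0 : ℝ)..1, ((s ^ (q - 1) : ℝ) : ℂ) *
      (((q : ℂ) - 1) * (2 * (1 - (s : ℂ)) + s * p) ^ ((q : ℂ) - 1 - 1) * s)) p := by
  obtain ⟨ε, hε, hball⟩ := Metric.nhds_basis_closedBall.mem_iff.1 (isOpen_slitPlane.mem_nhds hp)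
  have hcomp : IsCompact (Icc (0 : ℝ) 1 ×ˢ Metric.closedBall p ε) :=
    isCompact_Icc.prod (isCompact_closedBall p ε)
  have hcont : ContinuousOn (fun x : ℝ × ℂ =>
      ((q : ℂ) - 1) * (2 * (1 - (x.1 : ℂ)) + x.1 * x.2) ^ ((q : ℂ) - 1 - 1) * x.1)
      (Icc (0 : ℝ) 1 ×ˢ Metric.closedBall p ε) := by
    refine ContinuousOn.mul (continuousOn_const.mul ?_) (by fun_prop)
    refine ContinuousOn.cpow_const (by fun_prop) fun x hx => ?_
    exact convexComb_mem_slitPlane (hball hx.2) hx.1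
  obtain ⟨C, hC⟩ := hcomp.exists_bound_of_continuousOn hcont
  have hmeas : ∀ z ∈ slitPlane, IntervalIntegrable (fun s : ℝ => ((s ^ (q - 1) : ℝ) : ℂ) *
      (2 * (1 - (s : ℂ)) + s * z) ^ ((q : ℂ) - 1)) volume 0 1 := fun z hz =>
    intervalIntegrable_rpow_mul (by linarith) (continuousOn_convexComb_cpow hz _)
  refine (intervalIntegral.hasDerivAt_integral_of_dominated_loc_of_deriv_le
    (F := fun z (s : ℝ) => ((s ^ (q - 1) : ℝ) : ℂ) *
      (2 * (1 - (s : ℂ)) + s * z) ^ ((q : ℂ) - 1))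
    (F' := fun z (s : ℝ) => ((s ^ (q - 1) : ℝ) : ℂ) *
      (((q : ℂ) - 1) * (2 * (1 - (s : ℂ)) + s * z) ^ ((q : ℂ) - 1 - 1) * s))
    (bound := fun s : ℝ => s ^ (q - 1) * C)
    (Metric.closedBall_mem_nhds p hε) ?_ (hmeas p hp) ?_ ?_ ?_ ?_).2
  · filter_upwards [isOpen_slitPlane.mem_nhds hp] with z hz
    rw [uIoc_of_le zero_le_one]
    exact (hmeas z hz).1.aestronglyMeasurable
  · rw [uIoc_of_le zero_le_one]
    refine (intervalIntegrable_rpow_mul (a := q - 1) (by linarith) ?_).1.aestronglyMeasurable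
    exact (continuousOn_const.mul (continuousOn_convexComb_cpow hp _)).mul (by fun_prop)
  · refine Eventually.of_forall fun s hs z hz => ?_
    rw [uIoc_of_le zero_le_one] at hs
    have h1 := hC (s, z) ⟨⟨hs.1.le, hs.2⟩, hz⟩
    rw [norm_mul, norm_real, Real.norm_of_nonneg (Real.rpow_nonneg hs.1.le _)]
    exact mul_le_mul_of_nonneg_left h1 (Real.rpow_nonneg hs.1.le _)
  · exact (intervalIntegral.intervalIntegrable_rpow' (by linarith)).mul_const _
  · refine Eventually.of_forall fun s hs z hz => ?_
    rw [uIoc_of_le zero_le_one] at hs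
    have h1 : HasDerivAt (fun z : ℂ => 2 * (1 - (s : ℂ)) + s * z) (s : ℂ) z := by
      simpa using ((hasDerivAt_id z).const_mul (s : ℂ)).const_add (2 * (1 - (s : ℂ)))
    have h2 := h1.cpow_const (c := (q : ℂ) - 1)
      (convexComb_mem_slitPlane (hball hz) ⟨hs.1.le, hs.2⟩)
    exact h2.const_mul _

/-- Integrate over [0,1] the s-derivative of s^q (2(1-s)+sp)^(q-1); the only boundary term is
p^(q-1), from s = 1. -/
theorem eulerInt_ode {q : ℝ} (hq : 0 < q) {p : ℂ} (hp : p ∈ slitPlane) :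
    (2 - p) * deriv (eulerInt q) p = q * eulerInt q p - p ^ ((q : ℂ) - 1) := by
  rw [(hasDerivAt_eulerInt hq hp).deriv]
  have hi1 := intervalIntegrable_rpow_mul (a := q - 1) (by linarith)
    (continuousOn_convexComb_cpow hp ((q : ℂ) - 1))
  have hi2 := intervalIntegrable_rpow_mul (a := q - 1) (by linarith)
    (f := fun s : ℝ => ((q : ℂ) - 1) * (2 * (1 - (s : ℂ)) + s * p) ^ ((q : ℂ) - 1 - 1) * s)
    ((continuousOn_const.mul (continuousOn_convexComb_cpow hp _)).mul (by fun_prop))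
  have hftc := intervalIntegral.integral_eq_sub_of_hasDerivAt_of_le (a := 0) (b := 1)
    (f := fun s : ℝ => ((s ^ q : ℝ) : ℂ) * (2 * (1 - (s : ℂ)) + s * p) ^ ((q : ℂ) - 1))
    (f' := fun s : ℝ => q * (((s ^ (q - 1) : ℝ) : ℂ) * (2 * (1 - (s : ℂ)) + s * p) ^ ((q : ℂ) - 1))
      - (2 - p) * (((s ^ (q - 1) : ℝ) : ℂ) *
        (((q : ℂ) - 1) * (2 * (1 - (s : ℂ)) + s * p) ^ ((q : ℂ) - 1 - 1) * s)))
    zero_le_one ?_ ?_ ((hi1.const_mul _).sub (hi2.const_mul _))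
  · rw [intervalIntegral.integral_sub (hi1.const_mul _) (hi2.const_mul _),
      intervalIntegral.integral_const_mul, intervalIntegral.integral_const_mul] at hftc
    simp only [Real.one_rpow, ofReal_one, sub_self, mul_zero, zero_add, one_mul,
      Real.zero_rpow hq.ne', ofReal_zero, zero_mul, sub_zero] at hftc
    rw [eulerInt]
    linear_combination -hftc
  · refine ContinuousOn.mul ?_ (continuousOn_convexComb_cpow hp _)
    exact (continuous_ofReal.comp (Real.continuous_rpow_const hq.le)).continuousOn
  · intro s hs
    have hs0 : s ≠ 0 := hs.1.ne'
    have h1 : HasDerivAt (fun s : ℝ => ((s ^ q : ℝ) : ℂ)) ((q * s ^ (q - 1) : ℝ) : ℂ) s :=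
      (Real.hasDerivAt_rpow_const (Or.inl hs0)).ofReal_comp
    have h2 : HasDerivAt (fun z : ℂ => 2 * (1 - z) + z * p) (p - 2) (s : ℂ) := by
      have := (((hasDerivAt_id (s : ℂ)).const_sub 1).const_mul 2).fun_add
        ((hasDerivAt_id (s : ℂ)).mul_const p)
      convert! this using 1
      ring
    have h3 := (h2.cpow_const (c := (q : ℂ) - 1)
      (convexComb_mem_slitPlane hp ⟨hs.1.le, hs.2.le⟩)).comp_ofReal
    have h4 := h1.fun_mul h3
    convert! h4 using 1
    have e : ((s ^ q : ℝ) : ℂ) = ((s ^ (q - 1) : ℝ) : ℂ) * s := by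
      rw [← ofReal_mul, ← Real.rpow_add_one hs0, sub_add_cancel]
    rw [e]
    push_cast
    ring

/-- `i` times the analytic continuation of the Cauchy transform of the Student distribution, in
the coordinate `p = 1 - i z`. -/
noncomputable def studentCont (q : ℝ) (p : ℂ) : ℂ :=
  (2 * q - 1) * p ^ (-(q : ℂ)) * eulerInt q p

theorem hasDerivAt_studentCont {q : ℝ} (hq : 0 < q) {p : ℂ} (hp : p ∈ slitPlane) :
    HasDerivAt (studentCont q) ((2 * q - 1) * (-q * p ^ (-(q : ℂ) - 1)) * eulerInt q p
      + (2 * q - 1) * p ^ (-(q : ℂ)) * deriv (eulerInt q) p) p := by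
  have h1 := (hasDerivAt_eulerInt hq hp).differentiableAt.hasDerivAt
  have h2 : HasDerivAt (fun p : ℂ => p ^ (-(q : ℂ))) (-q * p ^ (-(q : ℂ) - 1)) p := by
    simpa using (hasDerivAt_id p).cpow_const (c := -(q : ℂ)) hp
  exact (h2.const_mul _).fun_mul h1

theorem differentiableOn_studentCont {q : ℝ} (hq : 0 < q) :
    DifferentiableOn ℂ (studentCont q) slitPlane := fun _ hp =>
  (hasDerivAt_studentCont hq hp).differentiableAt.differentiableWithinAt

theorem studentCont_ode {q : ℝ} (hq : 0 < q) {p : ℂ} (hp : p ∈ slitPlane) :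
    p * (2 - p) * deriv (studentCont q) p =
      2 * q * (p - 1) * studentCont q p - (2 * q - 1) := by
  have hp0 := slitPlane_ne_zero hp
  rw [(hasDerivAt_studentCont hq hp).deriv, studentCont]
  have h := eulerInt_ode hq hp
  have e1 : p ^ (-(q : ℂ) - 1) * p = p ^ (-(q : ℂ)) := by
    rw [cpow_sub _ _ hp0, cpow_one, div_mul_cancel₀ _ hp0]
  have e2 : p ^ (-(q : ℂ)) * (p * p ^ ((q : ℂ) - 1)) = 1 := by
    rw [cpow_sub _ _ hp0, cpow_one, mul_div_cancel₀ _ hp0, ← cpow_add _ _ hp0]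
    simp
  linear_combination (2 * q - 1) * (-(q : ℂ)) * (2 - p) * eulerInt q p * e1 +
    (2 * q - 1) * p ^ (-(q : ℂ)) * p * h - (2 * q - 1) * e2

theorem studentCont_conj (q : ℝ) {p : ℂ} (hp : p ∈ slitPlane) :
    studentCont q ((starRingEnd ℂ) p) = (starRingEnd ℂ) (studentCont q p) := by
  have hconj : ∀ z : ℂ, z ∈ slitPlane → ∀ a : ℝ, ((starRingEnd ℂ) z) ^ (a : ℂ) =
      (starRingEnd ℂ) (z ^ (a : ℂ)) := by
    intro z hz a
    rw [conj_cpow _ _ (mem_slitPlane_iff_arg.1 hz).1, conj_ofReal]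
  have h1 : eulerInt q ((starRingEnd ℂ) p) = (starRingEnd ℂ) (eulerInt q p) := by
    rw [eulerInt, eulerInt, intervalIntegral.intervalIntegral_eq_integral_uIoc,
      intervalIntegral.intervalIntegral_eq_integral_uIoc]
    simp only [zero_le_one, if_true, one_smul]
    rw [← integral_conj]
    refine setIntegral_congr_fun measurableSet_uIoc fun s hs => ?_
    rw [uIoc_of_le zero_le_one] at hs
    have := hconj _ (convexComb_mem_slitPlane hp ⟨hs.1.le, hs.2⟩) (q - 1)
    simp only [map_add, map_mul, map_sub, map_one, conj_ofReal, ofReal_sub, ofReal_one,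
      map_ofNat] at this ⊢
    rw [this]
  have h2 := hconj p hp (-q)
  rw [ofReal_neg] at h2
  rw [studentCont, studentCont, h1, h2]
  simp only [map_mul, map_sub, map_one, map_ofNat, conj_ofReal]

theorem studentCont_ofReal {q : ℝ} (hq : 1 / 2 < q) {x : ℝ} (hx : 0 < x) :
    (studentCont q x).im = 0 ∧ 0 < (studentCont q x).re := by
  have hpos : ∀ s ∈ Ioc (0 : ℝ) 1, 0 < 2 * (1 - s) + s * x := fun s hs => by
    have := mul_pos hs.1 hx
    have := hs.2
    linarith
  have h1 : eulerInt q x = ((∫ s in (0 : ℝ)..1, s ^ (q - 1) * (2 * (1 - s) + s * x) ^ (q - 1) : ℝ)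
      : ℂ) := by
    rw [eulerInt, ← intervalIntegral.integral_ofReal]
    refine intervalIntegral.integral_congr_ae (Eventually.of_forall fun s hs => ?_)
    rw [uIoc_of_le zero_le_one] at hs
    rw [ofReal_mul, ofReal_cpow (hpos s hs).le]
    push_cast
    rfl
  have h2 : 0 < ∫ s in (0 : ℝ)..1, s ^ (q - 1) * (2 * (1 - s) + s * x) ^ (q - 1) := by
    refine intervalIntegral.intervalIntegral_pos_of_pos_on ?_ (fun s hs => ?_) zero_lt_one
    · refine (intervalIntegral.intervalIntegrable_rpow' (by linarith)).mul_continuousOn ?_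
      rw [uIcc_of_le zero_le_one]
      refine ContinuousOn.rpow_const (by fun_prop) fun s hs => Or.inl ?_
      rcases eq_or_lt_of_le hs.1 with h | h
      · simp [← h]
      · exact (hpos s ⟨h, hs.2⟩).ne'
    · exact mul_pos (Real.rpow_pos_of_pos hs.1 _)
        (Real.rpow_pos_of_pos (hpos s ⟨hs.1, hs.2.le⟩) _)
  have h3 : studentCont q x = (((2 * q - 1) * x ^ (-q) *
      ∫ s in (0 : ℝ)..1, s ^ (q - 1) * (2 * (1 - s) + s * x) ^ (q - 1) : ℝ) : ℂ) := by
    rw [studentCont, h1, ← ofReal_neg, ← ofReal_cpow hx.le]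
    push_cast
    rfl
  rw [h3]
  refine ⟨ofReal_im _, ?_⟩
  rw [ofReal_re]
  exact mul_pos (mul_pos (by linarith) (Real.rpow_pos_of_pos hx _)) h2

/-- Decay of the continued transform in the right half-plane `Re p ≥ 1`. -/
theorem exists_norm_studentCont_le {q : ℝ} (hq : 1 / 2 < q) :
    ∃ C : ℝ, 0 < C ∧ ∀ p : ℂ, 1 ≤ p.re → ‖studentCont q p‖ ≤ C / ‖p‖ := by
  have hint : ∀ a : ℝ, -1 < a → IntervalIntegrable (fun s : ℝ => s ^ a) volume 0 1 :=
    fun a ha => intervalIntegral.intervalIntegrable_rpow' ha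
  -- The two summands serve the cases q ≥ 1 and q ≤ 1, where the power of X = 2(1-s)+sp is
  -- controlled by ‖X‖ ≤ 2‖p‖ and by ‖X‖ ≥ s‖p‖ respectively. Integrability of s^(2q-2) is where q >
  -- 1/2 enters.
  set b : ℝ → ℝ := fun s => s ^ (q - 1) * 2 ^ (q - 1) + s ^ (2 * q - 2) with hb
  have hbi : IntervalIntegrable b volume 0 1 :=
    ((hint _ (by linarith)).mul_const _).add (hint _ (by linarith))
  have hB : 0 < ∫ s in (0 : ℝ)..1, b s := by
    refine intervalIntegral.intervalIntegral_pos_of_pos_on hbi (fun s hs => ?_) zero_lt_one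
    have := hs.1
    positivity
  refine ⟨(2 * q - 1) * ∫ s in (0 : ℝ)..1, b s, mul_pos (by linarith) hB, fun p hp => ?_⟩
  have hpn : 1 ≤ ‖p‖ := hp.trans (re_le_norm p)
  have hp0 : 0 < ‖p‖ := by linarith
  have hps : p ∈ slitPlane := Or.inl (by linarith)
  have hbound : ‖eulerInt q p‖ ≤ ∫ s in (0 : ℝ)..1, b s * ‖p‖ ^ (q - 1) := by
    refine intervalIntegral.norm_integral_le_of_norm_le zero_le_one
      (Eventually.of_forall fun s hs => ?_) (hbi.mul_const _)
    have hX := convexComb_mem_slitPlane hps ⟨hs.1.le, hs.2⟩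
    set X := 2 * (1 - (s : ℂ)) + s * p with hXd
    have hX0 : 0 < ‖X‖ := norm_pos_iff.2 (slitPlane_ne_zero hX)
    have hlow : s * ‖p‖ ≤ ‖X‖ := by
      have h1 : (s * ‖p‖) ^ 2 ≤ ‖X‖ ^ 2 := by
        rw [mul_pow, ← normSq_eq_norm_sq, ← normSq_eq_norm_sq, normSq_apply, normSq_apply, hXd]
        simp only [add_re, mul_re, sub_re, one_re, ofReal_re, re_ofNat, im_ofNat, sub_im, one_im,
          ofReal_im, add_im, mul_im]
        have h2 := mul_nonneg (mul_nonneg hs.1.le (sub_nonneg.2 hs.2)) (by linarith : 0 ≤ p.re)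
        nlinarith [sq_nonneg (1 - s)]
      exact le_of_sq_le_sq h1 (norm_nonneg _)
    have hup : ‖X‖ ≤ 2 * ‖p‖ := by
      have h1 : ‖X‖ ≤ 2 * (1 - s) + s * ‖p‖ := by
        refine (norm_add_le _ _).trans ?_
        rw [norm_mul, norm_mul, norm_real, Real.norm_of_nonneg hs.1.le,
          ← ofReal_one, ← ofReal_sub, norm_real, Real.norm_of_nonneg (sub_nonneg.2 hs.2)]
        simp
      have := hs.1
      have := hs.2
      nlinarith
    have hn : ‖X ^ ((q : ℂ) - 1)‖ = ‖X‖ ^ (q - 1) := by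
      rw [← ofReal_one, ← ofReal_sub, norm_cpow_real]
    rw [norm_mul, norm_real, Real.norm_of_nonneg (Real.rpow_nonneg hs.1.le _), hn]
    have hs0 := hs.1
    rcases le_total 1 q with h | h
    · have h1 : ‖X‖ ^ (q - 1) ≤ 2 ^ (q - 1) * ‖p‖ ^ (q - 1) := by
        rw [← Real.mul_rpow (by norm_num) hp0.le]
        exact Real.rpow_le_rpow hX0.le hup (by linarith)
      calc s ^ (q - 1) * ‖X‖ ^ (q - 1) ≤ s ^ (q - 1) * (2 ^ (q - 1) * ‖p‖ ^ (q - 1)) := by gcongr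
        _ = s ^ (q - 1) * 2 ^ (q - 1) * ‖p‖ ^ (q - 1) := by ring
        _ ≤ b s * ‖p‖ ^ (q - 1) := by
          gcongr
          rw [hb]
          have : 0 ≤ s ^ (2 * q - 2) := by positivity
          simp only
          linarith
    · have h1 : ‖X‖ ^ (q - 1) ≤ s ^ (q - 1) * ‖p‖ ^ (q - 1) := by
        rw [← Real.mul_rpow hs0.le hp0.le]
        exact Real.rpow_le_rpow_of_nonpos (by positivity) hlow (by linarith)
      calc s ^ (q - 1) * ‖X‖ ^ (q - 1) ≤ s ^ (q - 1) * (s ^ (q - 1) * ‖p‖ ^ (q - 1)) := by gcongr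
        _ = s ^ (2 * q - 2) * ‖p‖ ^ (q - 1) := by
          rw [← mul_assoc, ← Real.rpow_add hs0]
          ring_nf
        _ ≤ b s * ‖p‖ ^ (q - 1) := by
          gcongr
          rw [hb]
          have : 0 ≤ s ^ (q - 1) * 2 ^ (q - 1) := by positivity
          simp only
          linarith
  rw [intervalIntegral.integral_mul_const] at hbound
  have hn : ‖p ^ (-(q : ℂ))‖ = ‖p‖ ^ (-q) := by rw [← ofReal_neg, norm_cpow_real]
  have hc : ‖(2 * (q : ℂ) - 1)‖ = 2 * q - 1 := by
    rw [show (2 * (q : ℂ) - 1) = ((2 * q - 1 : ℝ) : ℂ) by push_cast; ring, norm_real,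
      Real.norm_of_nonneg (by linarith)]
  rw [studentCont, norm_mul, norm_mul, hn, hc]
  calc (2 * q - 1) * ‖p‖ ^ (-q) * ‖eulerInt q p‖
      ≤ (2 * q - 1) * ‖p‖ ^ (-q) * ((∫ s in (0 : ℝ)..1, b s) * ‖p‖ ^ (q - 1)) := by
        refine mul_le_mul_of_nonneg_left hbound (mul_nonneg (by linarith) (by positivity))
    _ = (2 * q - 1) * (∫ s in (0 : ℝ)..1, b s) * (‖p‖ ^ (-q) * ‖p‖ ^ (q - 1)) := by ring
    _ = _ := by
      rw [← Real.rpow_add hp0, show -q + (q - 1) = -1 by ring, Real.rpow_neg_one]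
      ring

end FreeUI

/-! ### Homogeneous solutions and the reflection formula -/

namespace FreeUI
open Filter Topology Complex

/-- Holomorphic solutions of `p (2 - p) h' = 2 q (p - 1) h`. -/
theorem exists_eq_const_mul_of_homogeneous {q : ℝ} {U : Set ℂ} {h : ℂ → ℂ} (hU : IsOpen U)
    (hUc : IsPreconnected U) (hU1 : ∀ p ∈ U, p ∈ slitPlane) (hU2 : ∀ p ∈ U, 2 - p ∈ slitPlane)
    (hh : DifferentiableOn ℂ h U)
    (hode : ∀ p ∈ U, p * (2 - p) * deriv h p = 2 * q * (p - 1) * h p) :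
    ∃ a : ℂ, ∀ p ∈ U, h p = a * exp (-q * (log p + log (2 - p))) := by
  have hk : ∀ p ∈ U, HasDerivAt (fun p => h p * exp (q * (log p + log (2 - p)))) 0 p := by
    intro p hp
    have h1 := (hh.differentiableAt (hU.mem_nhds hp)).hasDerivAt
    have h2 : HasDerivAt (fun p : ℂ => log (2 - p)) (-1 / (2 - p)) p :=
      ((hasDerivAt_id p).const_sub 2).clog (hU2 p hp)
    have h3 := (((hasDerivAt_log (hU1 p hp)).fun_add h2).const_mul (q : ℂ)).cexp
    have h4 := h1.fun_mul h3
    convert! h4 using 1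
    have e1 := slitPlane_ne_zero (hU1 p hp)
    have e2 := slitPlane_ne_zero (hU2 p hp)
    have e3 : deriv h p = 2 * q * (p - 1) * h p / (p * (2 - p)) := by
      rw [← hode p hp]; field_simp
    rw [e3]
    field_simp
    ring
  obtain ⟨a, ha⟩ := hU.exists_is_const_of_deriv_eq_zero hUc
    (fun p hp => (hk p hp).differentiableAt.differentiableWithinAt) (fun p hp => (hk p hp).deriv)
  refine ⟨a, fun p hp => ?_⟩
  rw [← ha p hp, mul_assoc, ← exp_add]
  simp

theorem slitPlane_two_sub {p : ℂ} (hp : p.re < 2) : 2 - p ∈ slitPlane :=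
  Or.inl (by simpa using hp)

theorem isOpen_slitPlane_inter_re_lt (c : ℝ) : IsOpen (slitPlane ∩ {p : ℂ | p.re < c}) :=
  isOpen_slitPlane.inter (isOpen_lt continuous_re continuous_const)

/-- Reflection formula for the continued transform. -/
theorem exists_studentCont_reflection {q : ℝ} (hq : 1 / 2 < q) :
    ∃ A : ℝ, 0 < A ∧ ∀ p ∈ slitPlane, p.re < 2 →
      studentCont q p = A * exp (-q * (log p + log (2 - p))) - studentCont q (2 - p) := by
  have hq0 : 0 < q := by linarith
  set U : Set ℂ := slitPlane ∩ {p : ℂ | p.re < 2} with hU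
  have hstar : StarConvex ℝ 1 U := by
    refine starConvex_one_slitPlane.inter ?_
    have : Convex ℝ {p : ℂ | p.re < 2} := convex_halfSpace_re_lt 2
    exact this.starConvex (by simp)
  have hd2 : ∀ p ∈ U, HasDerivAt (fun p => studentCont q (2 - p))
      (-deriv (studentCont q) (2 - p)) p := by
    intro p hp
    have h1 := (hasDerivAt_studentCont hq0 (slitPlane_two_sub hp.2)).differentiableAt.hasDerivAt
    have h2 : HasDerivAt (fun p : ℂ => 2 - p) (-1) p := (hasDerivAt_id p).const_sub 2
    have := h1.comp p h2
    simpa [Function.comp_def] using this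
  have hd : ∀ p ∈ U, HasDerivAt (fun p => studentCont q p + studentCont q (2 - p))
      (deriv (studentCont q) p - deriv (studentCont q) (2 - p)) p := by
    intro p hp
    have h0 := (hasDerivAt_studentCont hq0 hp.1).differentiableAt.hasDerivAt
    exact h0.fun_add (hd2 p hp)
  -- Under p ↦ 2-p the homogeneous part of the equation is unchanged and the constant term changes
  -- sign, so the sum S(p) + S(2-p) is a homogeneous solution.
  obtain ⟨a, ha⟩ := exists_eq_const_mul_of_homogeneous (q := q) (isOpen_slitPlane_inter_re_lt 2)
    (hstar.isPathConnected ⟨by simp, by simp⟩).isConnected.isPreconnected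
    (fun p hp => hp.1) (fun p hp => slitPlane_two_sub hp.2)
    (fun p hp => (hd p hp).differentiableAt.differentiableWithinAt) (by
      intro p hp
      rw [(hd p hp).deriv]
      have h1 := studentCont_ode hq0 hp.1
      have h2 := studentCont_ode hq0 (slitPlane_two_sub hp.2)
      linear_combination h1 - h2)
  have h1 := ha 1 ⟨by simp, by simp⟩
  norm_num at h1
  obtain ⟨hi, hr⟩ := studentCont_ofReal hq one_pos
  rw [ofReal_one] at hi hr
  -- At the fixed point p = 1 of the reflection p(2-p) = 1, so the constant is 2S(1).
  refine ⟨2 * (studentCont q 1).re, by linarith, fun p hp hp2 => ?_⟩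
  have e : ((2 * (studentCont q 1).re : ℝ) : ℂ) = a := by
    rw [← h1]
    apply Complex.ext <;> simp [hi]
    ring
  have := ha p ⟨hp, hp2⟩
  rw [e, ← this]
  ring

/-! ### The differential equation of the Cauchy transform -/

theorem cauchyTransform_studentT {q : ℝ} (hq : 1 / 2 < q) (z : ℂ) :
    cauchyTransform (studentT q) z = ∫ x : ℝ, (studentPDF q x : ℂ) * (1 / (z - x)) :=
  integral_studentT hq _

theorem sub_ofReal_ne_zero {z : ℂ} (hz : 0 < z.im) (x : ℝ) : z - x ≠ 0 := by
  intro h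
  have := congrArg Complex.im h
  simp at this
  linarith

theorem im_le_norm_sub_ofReal (z : ℂ) (x : ℝ) : z.im ≤ ‖z - x‖ := by
  have := im_le_norm (z - x)
  simpa using this

theorem integrable_studentPDF_mul {q : ℝ} (hq : 1 / 2 < q) {z : ℂ} (hz : 0 < z.im) (n : ℕ) :
    Integrable fun x : ℝ => (studentPDF q x : ℂ) * (1 / (z - x) ^ n) := by
  refine (integrable_studentPDF hq).mul_bdd (c := (1 / z.im) ^ n) ?_ ?_
  · refine Continuous.aestronglyMeasurable ?_
    refine continuous_const.div (by fun_prop) fun x => pow_ne_zero _ (sub_ofReal_ne_zero hz x)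
  · refine Eventually.of_forall fun x => ?_
    rw [norm_div, norm_pow, norm_one, div_pow, one_pow]
    have := im_le_norm_sub_ofReal z x
    gcongr

theorem hasDerivAt_cauchyTransform_studentT {q : ℝ} (hq : 1 / 2 < q) {z : ℂ} (hz : 0 < z.im) :
    HasDerivAt (cauchyTransform (studentT q))
      (-∫ x : ℝ, (studentPDF q x : ℂ) * (1 / (z - x) ^ 2)) z := by
  have e : cauchyTransform (studentT q) =
      fun z => ∫ x : ℝ, (studentPDF q x : ℂ) * (1 / (z - x)) :=
    funext (cauchyTransform_studentT hq)
  rw [e, ← integral_neg]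
  have hs : {y : ℂ | z.im / 2 < y.im} ∈ 𝓝 z :=
    (isOpen_lt continuous_const continuous_im).mem_nhds (by simpa using hz)
  have hint := fun y : ℂ => fun hy : 0 < y.im => integrable_studentPDF_mul hq hy 1
  simp only [pow_one] at hint
  refine (hasDerivAt_integral_of_dominated_loc_of_deriv_le (μ := volume)
    (F := fun z (x : ℝ) => (studentPDF q x : ℂ) * (1 / (z - x)))
    (F' := fun z (x : ℝ) => -((studentPDF q x : ℂ) * (1 / (z - x) ^ 2)))
    (bound := fun x => ‖(studentPDF q x : ℂ)‖ * (1 / (z.im / 2) ^ 2)) hs ?_ (hint z hz) ?_ ?_ ?_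
    ?_).2
  · filter_upwards [hs] with y hy
    exact (hint y ((half_pos hz).trans hy)).aestronglyMeasurable
  · exact (integrable_studentPDF_mul hq hz 2).neg.aestronglyMeasurable
  · refine Eventually.of_forall fun x y hy => ?_
    have h1 : z.im / 2 < y.im := hy
    have h2 := im_le_norm_sub_ofReal y x
    have h3 : z.im / 2 ≤ ‖y - x‖ := by linarith
    rw [norm_neg, norm_mul, norm_div, norm_pow, norm_one]
    have h4 : 0 < z.im / 2 := half_pos hz
    gcongr
  · exact (integrable_studentPDF hq).norm.mul_const _
  · refine Eventually.of_forall fun x y hy => ?_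
    have h1 : z.im / 2 < y.im := hy
    have hne := sub_ofReal_ne_zero ((half_pos hz).trans h1) x
    have h2 : HasDerivAt (fun y : ℂ => 1 / (y - x)) (-1 / (y - x) ^ 2) y := by
      simpa using ((hasDerivAt_id y).sub_const (x : ℂ)).fun_inv hne
    convert! h2.const_mul (studentPDF q x : ℂ) using 1
    ring

/-- The Pearson equation of the density, the source of the differential equation for the Cauchy
transform. -/
theorem hasDerivAt_studentPDF (q x : ℝ) :
    HasDerivAt (fun x => (1 + x ^ 2) * studentPDF q x) (2 * (1 - q) * x * studentPDF q x) x := by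
  have hp : 0 < 1 + x ^ 2 := by positivity
  have h1 : HasDerivAt (fun x : ℝ => 1 + x ^ 2) (2 * x) x := by
    simpa using (hasDerivAt_pow 2 x).const_add 1
  have h2 := (h1.rpow_const (p := 1 - q) (Or.inl hp.ne')).const_mul
    (1 / ProbabilityTheory.beta (1 / 2) (q - 1 / 2))
  have e : ∀ y : ℝ, (1 + y ^ 2) * studentPDF q y =
      1 / ProbabilityTheory.beta (1 / 2) (q - 1 / 2) * (1 + y ^ 2) ^ (1 - q) := by
    intro y
    have hy : 0 < 1 + y ^ 2 := by positivity
    rw [studentPDF, Real.rpow_sub hy, Real.rpow_one]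
    ring
  simp_rw [e]
  convert! h2 using 1
  rw [show 1 - q - 1 = -q by ring, studentPDF, Real.rpow_neg hp.le]
  ring

theorem one_add_sq_le_norm_sub_ofReal {z : ℂ} (hz : 0 < z.im) (x : ℝ) :
    1 + x ^ 2 ≤ (2 + (2 * z.re ^ 2 + 1) / z.im ^ 2) * ‖z - x‖ ^ 2 := by
  rw [← normSq_eq_norm_sq, normSq_apply]
  simp only [sub_re, ofReal_re, sub_im, ofReal_im, sub_zero]
  have h1 : (2 * z.re ^ 2 + 1) / z.im ^ 2 * (z.im * z.im) = 2 * z.re ^ 2 + 1 := by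
    field_simp
  have h2 : 0 ≤ (2 * z.re ^ 2 + 1) / z.im ^ 2 * ((z.re - x) * (z.re - x)) :=
    mul_nonneg (by positivity) (mul_self_nonneg _)
  nlinarith [sq_nonneg (x - 2 * z.re), sq_nonneg z.im]

/-- The boundary term of the integration by parts; it decays like |x|^(1-2q). -/
theorem tendsto_studentPDF_mul_div {q : ℝ} (hq : 1 / 2 < q) {z : ℂ} (hz : 0 < z.im)
    {l : Filter ℝ} (hl : Tendsto (fun x : ℝ => |x|) l atTop) :
    Tendsto (fun x : ℝ => (((1 + x ^ 2) * studentPDF q x : ℝ) : ℂ) * (1 / (z - x))) l (𝓝 0) := by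
  set K := 2 + (2 * z.re ^ 2 + 1) / z.im ^ 2 with hK
  have hK0 : 0 < K := by positivity
  set b := 1 / ProbabilityTheory.beta (1 / 2) (q - 1 / 2) with hb
  have hb0 : 0 < b :=
    one_div_pos.2 (ProbabilityTheory.beta_pos (by norm_num) (by linarith))
  have h1 : Tendsto (fun x : ℝ => b * (1 + x ^ 2) ^ (-(q - 1 / 2)) * Real.sqrt K) l (𝓝 0) := by
    have h2 : Tendsto (fun x : ℝ => 1 + x ^ 2) l atTop := by
      refine tendsto_atTop_mono (fun x => ?_) hl
      have := sq_abs x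
      nlinarith [sq_nonneg (|x| - 1), abs_nonneg x]
    have h3 := (tendsto_rpow_neg_atTop (by linarith : 0 < q - 1 / 2)).comp h2
    simpa using (h3.const_mul b).mul_const (Real.sqrt K)
  refine squeeze_zero_norm (fun x => ?_) h1
  have hx : 0 < 1 + x ^ 2 := by positivity
  have hn : 0 < ‖z - x‖ := norm_pos_iff.2 (sub_ofReal_ne_zero hz x)
  have h4 : Real.sqrt (1 + x ^ 2) ≤ Real.sqrt K * ‖z - x‖ := by
    rw [← Real.sqrt_sq hn.le, ← Real.sqrt_mul hK0.le]
    exact Real.sqrt_le_sqrt (one_add_sq_le_norm_sub_ofReal hz x)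
  have h5 : (1 + x ^ 2) * studentPDF q x =
      b * (1 + x ^ 2) ^ (-(q - 1 / 2)) * Real.sqrt (1 + x ^ 2) := by
    rw [Real.sqrt_eq_rpow, mul_assoc, ← Real.rpow_add hx,
      show -(q - 1 / 2) + 1 / 2 = 1 - q by ring, studentPDF, Real.rpow_sub hx, Real.rpow_one]
    ring
  rw [norm_mul, norm_real, h5, norm_div, norm_one, Real.norm_of_nonneg (by positivity),
    mul_one_div, div_le_iff₀ hn, mul_assoc _ (Real.sqrt K)]
  gcongr

/-- The x-derivative of (1+x²)ρ(x)/(z-x), with ρ the density, integrates to 0 over the line.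
Expanding it in powers of z-x leaves only multiples of the transform, its derivative and the total
mass. -/
theorem cauchyTransform_studentT_ode {q : ℝ} (hq : 1 / 2 < q) {z : ℂ} (hz : 0 < z.im) :
    (1 + z ^ 2) * deriv (cauchyTransform (studentT q)) z =
      -(2 * q * z * cauchyTransform (studentT q) z) + (2 * q - 1) := by
  have i0 := integrable_studentPDF_mul hq hz 0
  have i1 := integrable_studentPDF_mul hq hz 1
  have i2 := integrable_studentPDF_mul hq hz 2
  simp only [pow_zero, pow_one, div_one, mul_one] at i0 i1
  have hint : Integrable fun x : ℝ => (1 + z ^ 2) * ((studentPDF q x : ℂ) * (1 / (z - x) ^ 2))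
      - 2 * q * z * ((studentPDF q x : ℂ) * (1 / (z - x))) + (2 * q - 1) * studentPDF q x :=
    ((i2.const_mul _).sub (i1.const_mul _)).add (i0.const_mul _)
  have h := integral_of_hasDerivAt_of_tendsto
    (f := fun x : ℝ => (((1 + x ^ 2) * studentPDF q x : ℝ) : ℂ) * (1 / (z - x))) (f' := _)
    ?_ hint (tendsto_studentPDF_mul_div hq hz tendsto_abs_atBot_atTop)
    (tendsto_studentPDF_mul_div hq hz tendsto_abs_atTop_atTop)
  · rw [integral_add (f := fun x : ℝ => (1 + z ^ 2) * ((studentPDF q x : ℂ) * (1 / (z - x) ^ 2))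
      - 2 * q * z * ((studentPDF q x : ℂ) * (1 / (z - x))))
      ((i2.const_mul _).sub (i1.const_mul _)) (i0.const_mul _),
      integral_sub (i2.const_mul _) (i1.const_mul _), integral_const_mul, integral_const_mul,
      integral_const_mul, integral_studentPDF hq] at h
    rw [(hasDerivAt_cauchyTransform_studentT hq hz).deriv, cauchyTransform_studentT hq]
    linear_combination -h
  · intro x
    have hne := sub_ofReal_ne_zero hz x
    have h1 := (hasDerivAt_studentPDF q x).ofReal_comp
    have h2 : HasDerivAt (fun x : ℝ => 1 / (z - (x : ℂ))) (1 / (z - x) ^ 2) x := by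
      have : HasDerivAt (fun y : ℂ => 1 / (z - y)) (1 / (z - x) ^ 2) (x : ℂ) := by
        simpa using ((hasDerivAt_id (x : ℂ)).const_sub z).fun_inv hne
      exact this.comp_ofReal
    convert! h1.fun_mul h2 using 1
    push_cast
    field_simp
    ring

/-- The continued transform is the Cauchy transform on the upper half-plane. -/
theorem studentCont_eq_cauchyTransform {q : ℝ} (hq : 1 / 2 < q) {p : ℂ} (hp : 1 < p.re) :
    studentCont q p = I * cauchyTransform (studentT q) (I * (p - 1)) := by
  have hq0 : 0 < q := by linarith
  set V : Set ℂ := {p : ℂ | 1 < p.re} with hV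
  have hVo : IsOpen V := isOpen_lt continuous_const continuous_re
  have hVc : Convex ℝ V := convex_halfSpace_re_gt 1
  set h : ℂ → ℂ := fun p => studentCont q p - I * cauchyTransform (studentT q) (I * (p - 1))
    with hh
  have hVs : ∀ p ∈ V, p ∈ slitPlane := fun p hp => Or.inl (zero_lt_one.trans hp)
  have him : ∀ p ∈ V, 0 < (I * (p - 1)).im := fun p hp => by
    have : (1 : ℝ) < p.re := hp
    simpa using this
  have hd : ∀ p ∈ V, HasDerivAt h (deriv (studentCont q) p +
      deriv (cauchyTransform (studentT q)) (I * (p - 1))) p := by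
    intro p hp
    have h0 := (hasDerivAt_studentCont hq0 (hVs p hp)).differentiableAt.hasDerivAt
    have h1 := (hasDerivAt_cauchyTransform_studentT hq (him p hp)).differentiableAt.hasDerivAt
    have h2 : HasDerivAt (fun p : ℂ => I * (p - 1)) I p := by
      simpa using ((hasDerivAt_id p).sub_const 1).const_mul I
    have h3 := h0.fun_sub ((h1.comp p h2).const_mul I)
    convert! h3 using 1
    linear_combination deriv (cauchyTransform (studentT q)) (I * (p - 1)) * I_sq
  have hdiff : DifferentiableOn ℂ h V := fun p hp =>
    (hd p hp).differentiableAt.differentiableWithinAt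
  set U : Set ℂ := V ∩ {p : ℂ | p.re < 2} with hU
  have hUo : IsOpen U := hVo.inter (isOpen_lt continuous_re continuous_const)
  have hUc : Convex ℝ U := hVc.inter (convex_halfSpace_re_lt 2)
  -- Both functions satisfy the same inhomogeneous equation, so on the strip 1 < Re p < 2 their
  -- difference is a multiple of (p(2-p))^(-q).
  obtain ⟨a, ha⟩ := exists_eq_const_mul_of_homogeneous (q := q) (h := h) hUo hUc.isPreconnected
    (fun p hp => hVs p hp.1) (fun p hp => slitPlane_two_sub hp.2)
    (hdiff.mono inter_subset_left) (by
      intro p hp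
      rw [(hd p hp.1).deriv]
      have h1 := studentCont_ode hq0 (hVs p hp.1)
      have h2 := cauchyTransform_studentT_ode hq (him p hp.1)
      simp only [hh]
      have e : (1 + (I * (p - 1)) ^ 2) = p * (2 - p) := by
        rw [mul_pow, I_sq]; ring
      rw [e] at h2
      linear_combination h1 + h2)
  -- The difference is holomorphic at p = 2, where (p(2-p))^(-q) is unbounded. Multiplying by p^q
  -- (2-p)^q and letting p tend to 2 along the reals gives a = 0.
  have ha0 : a = 0 := by
    have hlim : Tendsto (fun t : ℝ => h t * exp (q * log t) * ((2 - t : ℝ) : ℂ) ^ (q : ℂ))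
        (𝓝[<] 2) (𝓝 (h 2 * exp (q * log 2) * 0)) := by
      refine Tendsto.mul (Tendsto.mul ?_ ?_) ?_
      · have h1 : ContinuousAt h ((2 : ℝ) : ℂ) :=
          (hdiff.differentiableAt (hVo.mem_nhds (by simp [hV]))).continuousAt
        have h2 : ContinuousAt (fun t : ℝ => h t) 2 :=
          ContinuousAt.comp (f := fun t : ℝ => (t : ℂ)) h1 continuous_ofReal.continuousAt
        simpa using h2.tendsto.mono_left nhdsWithin_le_nhds
      · have h1 : ContinuousAt (fun t : ℝ => exp (q * log (t : ℂ))) 2 := by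
          refine ContinuousAt.cexp (continuousAt_const.mul ?_)
          exact ContinuousAt.clog continuous_ofReal.continuousAt (by simp)
        simpa using h1.tendsto.mono_left nhdsWithin_le_nhds
      · have h1 : Tendsto (fun t : ℝ => (((2 - t) ^ q : ℝ) : ℂ)) (𝓝 2) (𝓝 0) := by
          have : Continuous (fun t : ℝ => (((2 - t) ^ q : ℝ) : ℂ)) :=
            continuous_ofReal.comp (Continuous.rpow_const (by fun_prop) fun _ => Or.inr hq0.le)
          have h := this.tendsto 2
          simpa [Real.zero_rpow hq0.ne'] using h
        refine (h1.mono_left nhdsWithin_le_nhds).congr' ?_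
        filter_upwards [self_mem_nhdsWithin] with t ht
        exact ofReal_cpow (sub_nonneg.2 (le_of_lt ht)) _
    rw [mul_zero] at hlim
    have hconst : ∀ᶠ t : ℝ in 𝓝[<] 2,
        h t * exp (q * log t) * ((2 - t : ℝ) : ℂ) ^ (q : ℂ) = a := by
      filter_upwards [self_mem_nhdsWithin, nhdsWithin_le_nhds (lt_mem_nhds one_lt_two)]
        with t ht ht1
      have ht2 : t < 2 := ht
      have hne : ((2 - t : ℝ) : ℂ) ≠ 0 := by
        rw [ofReal_ne_zero]; linarith
      rw [ha t ⟨by simpa [hV] using ht1, by simpa using ht2⟩, cpow_def_of_ne_zero hne, mul_assoc,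
        mul_assoc, ← exp_add, ← exp_add]
      push_cast
      rw [show -(q : ℂ) * (log t + log (2 - t)) + (q * log t + log (2 - t) * q) = 0 by ring]
      simp
    exact tendsto_nhds_unique (tendsto_const_nhds.congr' (hconst.mono fun t ht => ht.symm)) hlim
  have hzero : EqOn h 0 V := by
    refine (hdiff.analyticOnNhd hVo).eqOn_zero_of_preconnected_of_eventuallyEq_zero
      hVc.isPreconnected (z₀ := (3 / 2 : ℂ)) (by simp [hV]; norm_num) ?_
    have : U ∈ 𝓝 (3 / 2 : ℂ) := hUo.mem_nhds (by simp [hU, hV]; norm_num)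
    filter_upwards [this] with p hp
    rw [ha p hp, ha0]
    simp
  exact sub_eq_zero.1 (hzero hp)

theorem cauchyTransform_eq_studentCont {q : ℝ} (hq : 1 / 2 < q) {z : ℂ} (hz : 0 < z.im) :
    cauchyTransform (studentT q) z = -I * studentCont q (1 - I * z) := by
  rw [studentCont_eq_cauchyTransform hq (by simpa using hz)]
  rw [show I * (1 - I * z - 1) = z by linear_combination -z * I_sq]
  linear_combination cauchyTransform (studentT q) z * I_sq

/-- The real part of i/(z-x) is the positive kernel Im z / |z-x|². -/
theorem re_studentCont_pos {q : ℝ} (hq : 1 / 2 < q) {p : ℂ} (hp : 1 < p.re) :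
    0 < (studentCont q p).re := by
  have hz : 0 < (I * (p - 1)).im := by simpa using hp
  rw [studentCont_eq_cauchyTransform hq hp, cauchyTransform_studentT hq, ← integral_const_mul]
  set z := I * (p - 1) with hzd
  have hint := (integrable_studentPDF_mul hq hz 1).const_mul I
  simp only [pow_one] at hint
  have e := integral_re hint
  simp only [RCLike.re_to_complex] at e
  rw [← e]
  have hval : ∀ x : ℝ, (I * ((studentPDF q x : ℂ) * (1 / (z - x)))).re =
      studentPDF q x * (z.im / normSq (z - x)) := by
    intro x
    rw [show I * ((studentPDF q x : ℂ) * (1 / (z - x))) = (studentPDF q x : ℂ) * (I * (z - x)⁻¹) by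
      ring, re_ofReal_mul]
    simp [inv_im]
    ring
  have hpos : ∀ x : ℝ, 0 < (I * ((studentPDF q x : ℂ) * (1 / (z - x)))).re := by
    intro x
    rw [hval]
    have := studentPDF_pos hq x
    have := normSq_pos.2 (sub_ofReal_ne_zero hz x)
    positivity
  rw [integral_pos_iff_support_of_nonneg (fun x => (hpos x).le) hint.re]
  have : Function.support (fun x : ℝ => (I * ((studentPDF q x : ℂ) * (1 / (z - x)))).re) = univ :=
    eq_univ_of_forall fun x => (hpos x).ne'
  rw [this]
  simp

end FreeUI

/-! ### The conformal map onto the right half-plane -/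

namespace FreeUI
open Filter Topology Complex

/-- The argument of `p (2 - p)`. -/
noncomputable def argSum (p : ℂ) : ℝ := arg p + arg (2 - p)

/-- The domain of the continued transform: the half-plane `Re p > 1` together with the part of the
half-plane `Re p < 2` in which `(p (2 - p))^q` has positive real part. -/
def studentDom (q : ℝ) : Set ℂ :=
  {p | 1 < p.re} ∪ ((slitPlane ∩ {p | p.re < 2}) ∩ {p | q * |argSum p| < Real.pi / 2})

/-- The part of `studentDom` that the continued transform maps into the right half-plane. -/
def studentReg (q : ℝ) : Set ℂ := {p ∈ studentDom q | 0 < (studentCont q p).re}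

theorem studentDom_subset_slitPlane (q : ℝ) : studentDom q ⊆ slitPlane := by
  rintro p (hp | hp)
  · exact Or.inl (zero_lt_one.trans hp)
  · exact hp.1.1

theorem continuousAt_argSum {p : ℂ} (hp : p ∈ slitPlane) (hp2 : p.re < 2) :
    ContinuousAt argSum p := by
  have h1 : ContinuousAt (fun p : ℂ => arg (2 - p)) p :=
    ContinuousAt.comp (f := fun p : ℂ => 2 - p) (continuousAt_arg (slitPlane_two_sub hp2))
      (by fun_prop)
  exact (continuousAt_arg hp).add h1

theorem isOpen_studentDom (q : ℝ) : IsOpen (studentDom q) := by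
  refine (isOpen_lt continuous_const continuous_re).union ?_
  have hc : ContinuousOn (fun p => q * |argSum p|) (slitPlane ∩ {p : ℂ | p.re < 2}) :=
    fun p hp => ((continuousAt_argSum hp.1 hp.2).abs.const_mul q).continuousWithinAt
  exact hc.isOpen_inter_preimage (isOpen_slitPlane_inter_re_lt 2) isOpen_Iio

theorem continuousOn_studentCont {q : ℝ} (hq : 0 < q) : ContinuousOn (studentCont q) slitPlane :=
  (differentiableOn_studentCont hq).continuousOn

theorem isOpen_studentReg {q : ℝ} (hq : 0 < q) : IsOpen (studentReg q) := by
  have hc : ContinuousOn (fun p => (studentCont q p).re) (studentDom q) :=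
    continuous_re.comp_continuousOn
      ((continuousOn_studentCont hq).mono (studentDom_subset_slitPlane q))
  exact hc.isOpen_inter_preimage (isOpen_studentDom q) isOpen_Ioi

theorem exp_log_add_log (q : ℝ) {p : ℂ} (hp : p ≠ 0) (hp2 : 2 - p ≠ 0) :
    exp (-q * (log p + log (2 - p))) = p ^ ((-q : ℝ) : ℂ) * (2 - p) ^ ((-q : ℝ) : ℂ) := by
  rw [cpow_def_of_ne_zero hp, cpow_def_of_ne_zero hp2, ← exp_add]
  push_cast
  ring_nf

theorem norm_exp_log_add_log (q : ℝ) {p : ℂ} (hp : p ≠ 0) (hp2 : 2 - p ≠ 0) :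
    ‖exp (-q * (log p + log (2 - p)))‖ = ‖p‖ ^ (-q) * ‖2 - p‖ ^ (-q) := by
  rw [exp_log_add_log q hp hp2, norm_mul, norm_cpow_real, norm_cpow_real]

theorem im_neg_mul_log_add_log (q : ℝ) (p : ℂ) :
    (-q * (log p + log (2 - p)) : ℂ).im = -(q * argSum p) := by
  simp [argSum, log_im]

theorem abs_arg_eq_arccos {z : ℂ} (hz : z ≠ 0) : |arg z| = Real.arccos (z.re / ‖z‖) := by
  rw [← cos_arg hz, ← Real.cos_abs, Real.arccos_cos (abs_nonneg _) (abs_arg_le_pi z)]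

/-- Unlike `arg`, its absolute value is continuous across the negative axis; this handles sequences
that approach the cut from either side. -/
theorem continuousAt_abs_arg {z : ℂ} (hz : z ≠ 0) : ContinuousAt (fun z => |arg z|) z := by
  have h1 : ContinuousAt (fun z : ℂ => Real.arccos (z.re / ‖z‖)) z :=
    Real.continuous_arccos.continuousAt.comp
      (continuous_re.continuousAt.div continuous_norm.continuousAt (norm_ne_zero_iff.2 hz))
  refine h1.congr ?_
  filter_upwards [isOpen_ne.mem_nhds hz] with y hy
  exact (abs_arg_eq_arccos hy).symm

/-- A bound for the continued transform on the whole slit plane. -/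
theorem exists_norm_studentCont_le_slitPlane {q : ℝ} (hq : 1 / 2 < q) :
    ∃ A C : ℝ, 0 < A ∧ 0 < C ∧
      (∀ p ∈ slitPlane, p.re < 2 →
        studentCont q p = A * exp (-q * (log p + log (2 - p))) - studentCont q (2 - p)) ∧
      (∀ p : ℂ, 1 ≤ p.re → ‖studentCont q p‖ ≤ C) ∧
      ∀ p ∈ slitPlane, ‖studentCont q p‖ ≤ A * ‖p‖ ^ (-q) + C / ‖p‖ := by
  obtain ⟨A, hA, hrefl⟩ := exists_studentCont_reflection hq
  obtain ⟨C, hC, hbd⟩ := exists_norm_studentCont_le hq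
  refine ⟨A, C, hA, hC, hrefl, fun p hp => ?_, fun p hp => ?_⟩
  · refine (hbd p hp).trans (div_le_self hC.le (hp.trans (re_le_norm p)))
  · have hp0 : 0 < ‖p‖ := norm_pos_iff.2 (slitPlane_ne_zero hp)
    -- For Re p < 1 the reflection formula transfers the decay from 2-p, which is farther from 0
    -- than p.
    rcases le_or_gt 1 p.re with h | h
    · have : 0 ≤ A * ‖p‖ ^ (-q) := by positivity
      linarith [hbd p h]
    · have h2 : 1 ≤ (2 - p).re := by simp; linarith
      have hn1 : 1 ≤ ‖2 - p‖ := h2.trans (re_le_norm _)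
      have hn2 : ‖p‖ ≤ ‖2 - p‖ := by
        refine le_of_sq_le_sq ?_ (norm_nonneg _)
        rw [← normSq_eq_norm_sq, ← normSq_eq_norm_sq, normSq_apply, normSq_apply]
        simp
        nlinarith
      have e := hrefl p hp (by linarith)
      rw [e]
      refine (norm_sub_le _ _).trans (add_le_add ?_ ?_)
      · rw [norm_mul, norm_real, Real.norm_of_nonneg hA.le, norm_exp_log_add_log q
          (slitPlane_ne_zero hp) (norm_pos_iff.1 (by linarith))]
        have h3 : ‖2 - p‖ ^ (-q) ≤ 1 := Real.rpow_le_one_of_one_le_of_nonpos hn1 (by linarith)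
        have h4 : 0 ≤ ‖p‖ ^ (-q) := by positivity
        nlinarith [mul_le_mul_of_nonneg_left h3 h4]
      · exact (hbd _ h2).trans (by gcongr)

/-- Here 2-p is the conjugate of p. So the line Re p = 1 lies in the second piece of `studentDom`
and contributes no boundary. -/
theorem argSum_eq_zero_of_re_eq_one {p : ℂ} (hp : p.re = 1) : argSum p = 0 := by
  have h : 2 - p = (starRingEnd ℂ) p := by
    apply Complex.ext <;> simp [hp]
    norm_num
  have h2 : arg p ≠ Real.pi := by
    rw [Ne, arg_eq_pi_iff, hp]
    rintro ⟨h, _⟩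
    linarith
  rw [argSum, h, arg_conj, if_neg h2]
  ring

/-- A locally constant value c would satisfy 2q(p-1)c = 2q-1 for all p near z, hence c = 0 and 2q =
1. -/
theorem not_eventually_studentCont_eq {q : ℝ} (hq : 1 / 2 < q) {z : ℂ} (hz : z ∈ slitPlane) :
    ¬ ∀ᶠ z' in 𝓝 z, studentCont q z' = studentCont q z := by
  intro h
  set c := studentCont q z with hc
  have h1 : studentCont q =ᶠ[𝓝 z] fun _ => c := h
  have h2 : (fun y : ℂ => 2 * q * (y - 1) * c - (2 * q - 1)) =ᶠ[𝓝 z] fun _ => 0 := by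
    filter_upwards [h1.deriv, h1, isOpen_slitPlane.mem_nhds hz] with y hy hy1 hys
    have := studentCont_ode (by linarith : 0 < q) hys
    rw [hy, hy1] at this
    simpa using this.symm
  have h3 : HasDerivAt (fun y : ℂ => 2 * q * (y - 1) * c - (2 * q - 1)) (2 * q * c) z := by
    simpa using ((((hasDerivAt_id z).sub_const 1).const_mul (2 * (q : ℂ))).mul_const c).sub_const
      (2 * (q : ℂ) - 1)
  have h4 : 2 * (q : ℂ) * c = 0 := by
    rw [← h3.deriv, h2.deriv_eq, deriv_const]
  have h5 := h2.self_of_nhds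
  simp only at h5
  have h6 : 2 * (q : ℂ) - 1 = 0 := by linear_combination (z - 1) * h4 - h5
  have h7 : 2 * q - 1 = 0 := by exact_mod_cast h6
  linarith

/-- A sequence whose values tend to w ≠ 0 is eventually bounded, since S decays at infinity. It
remains to exclude limit points on the boundary of `studentDom`, at 0 and on the cut. -/
theorem studentCont_proper {q : ℝ} (hq : 1 / 2 < q) {w : ℂ} (hw : 0 < w.re) {u : ℕ → ℂ}
    (hu : ∀ n, u n ∈ studentReg q) (hlim : Tendsto (studentCont q ∘ u) atTop (𝓝 w)) :
    ∃ z ∈ studentReg q, ∃ φ : ℕ → ℕ, StrictMono φ ∧ Tendsto (u ∘ φ) atTop (𝓝 z) := by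
  have hq0 : 0 < q := by linarith
  obtain ⟨A, C, hA, hC, hrefl, hbd1, hbd⟩ := exists_norm_studentCont_le_slitPlane hq
  have hw0 : 0 < ‖w‖ := hw.trans_le (re_le_norm w)
  obtain ⟨R, hR⟩ : ∃ R : ℝ, ∀ r : ℝ, R < r → A * r ^ (-q) + C / r < ‖w‖ / 2 := by
    have h1 : Tendsto (fun r : ℝ => A * r ^ (-q) + C / r) atTop (𝓝 (A * 0 + 0)) :=
      ((tendsto_rpow_neg_atTop hq0).const_mul A).add (tendsto_const_nhds.div_atTop tendsto_id)
    have h2 : ∀ᶠ r : ℝ in atTop, A * r ^ (-q) + C / r < ‖w‖ / 2 :=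
      h1.eventually (gt_mem_nhds (by simpa using half_pos hw0))
    obtain ⟨R, hR⟩ := eventually_atTop.1 h2
    exact ⟨R, fun r hr => hR r hr.le⟩
  have hev : ∀ᶠ n in atTop, u n ∈ Metric.closedBall (0 : ℂ) R := by
    have h1 : ∀ᶠ n in atTop, ‖w‖ / 2 < ‖studentCont q (u n)‖ :=
      hlim.norm.eventually (lt_mem_nhds (half_lt_self hw0))
    filter_upwards [h1] with n hn
    rw [mem_closedBall_zero_iff]
    by_contra hcon
    have := hbd (u n) (studentDom_subset_slitPlane q (hu n).1)
    linarith [hR _ (not_le.1 hcon)]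
  obtain ⟨p, -, φ, hφ, hp⟩ := tendsto_subseq_of_frequently_bounded Metric.isBounded_closedBall
    hev.frequently
  set v := u ∘ φ with hv
  have hvreg : ∀ n, v n ∈ studentReg q := fun n => hu _
  have hvs : ∀ n, v n ∈ slitPlane := fun n => studentDom_subset_slitPlane q (hvreg n).1
  have hvlim : Tendsto (fun n => studentCont q (v n)) atTop (𝓝 w) := hlim.comp hφ.tendsto_atTop
  refine ⟨p, ?_, φ, hφ, hp⟩
  have hsecond : p.re < 1 → ∀ᶠ n in atTop, (v n).re < 1 ∧ q * |argSum (v n)| < Real.pi / 2 := by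
    intro h
    filter_upwards [(continuous_re.tendsto p).comp hp |>.eventually (gt_mem_nhds h)] with n hn
    have hn' : (v n).re < 1 := hn
    refine ⟨hn', ?_⟩
    rcases (hvreg n).1 with h1 | h1
    · exact absurd (h1 : 1 < (v n).re) (not_lt.2 hn'.le)
    · exact h1.2
  by_cases hps : p ∈ slitPlane
  · have hpw : studentCont q p = w := by
      refine tendsto_nhds_unique ?_ hvlim
      exact ((continuousOn_studentCont hq0).continuousAt
        (isOpen_slitPlane.mem_nhds hps)).tendsto.comp hp
    refine ⟨?_, by rw [hpw]; exact hw⟩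
    by_contra hdom
    have hre : p.re ≤ 1 := not_lt.1 fun h => hdom (Or.inl h)
    have harg : Real.pi / 2 ≤ q * |argSum p| :=
      not_lt.1 fun h => hdom (Or.inr ⟨⟨hps, lt_of_le_of_lt hre one_lt_two⟩, h⟩)
    have hre1 : p.re < 1 := by
      refine lt_of_le_of_ne hre fun h => ?_
      rw [argSum_eq_zero_of_re_eq_one h] at harg
      simp at harg
      linarith [Real.pi_pos]
    have hcont : Tendsto (fun n => q * |argSum (v n)|) atTop (𝓝 (q * |argSum p|)) :=
      ((continuousAt_argSum hps (by linarith)).abs.const_mul q).tendsto.comp hp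
    have harg2 : q * |argSum p| ≤ Real.pi / 2 :=
      le_of_tendsto hcont ((hsecond hre1).mono fun n hn => hn.2.le)
    -- At a boundary point (p(2-p))^(-q) is purely imaginary, so Re w = -Re S(2-p) < 0.
    have hcos : Real.cos (q * argSum p) = 0 := by
      rw [← Real.cos_abs, abs_mul, abs_of_pos hq0, le_antisymm harg2 harg, Real.cos_pi_div_two]
    have e := congrArg Complex.re (hrefl p hps (by linarith))
    rw [sub_re, re_ofReal_mul, exp_re, im_neg_mul_log_add_log, Real.cos_neg, hcos, hpw] at e
    have := re_studentCont_pos hq (p := 2 - p) (by simp; linarith)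
    simp at e
    linarith
  · exfalso
    rw [mem_slitPlane_iff, not_or, not_lt, not_not] at hps
    have hre1 : p.re < 1 := by linarith [hps.1]
    by_cases hp0 : p = 0
    · subst hp0
      have h2 : Tendsto (fun n => studentCont q (2 - v n)) atTop (𝓝 (studentCont q (2 - 0))) := by
        have hc : ContinuousAt (studentCont q) (2 - 0) :=
          (continuousOn_studentCont hq0).continuousAt (isOpen_slitPlane.mem_nhds (by simp))
        exact hc.tendsto.comp (hp.const_sub 2)
      have h3 : Tendsto (fun n => ‖v n‖ ^ q) atTop (𝓝 0) := by
        have := ((Real.continuous_rpow_const hq0.le).tendsto _).comp hp.norm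
        simpa [Real.zero_rpow hq0.ne', Function.comp_def] using this
      have h4 : Tendsto (fun n => ‖2 - v n‖ ^ q) atTop (𝓝 (‖(2 : ℂ) - 0‖ ^ q)) :=
        ((Real.continuous_rpow_const hq0.le).tendsto _).comp (hp.const_sub 2).norm
      have h5 := ((hvlim.add h2).norm.mul h3).mul h4
      rw [mul_zero, zero_mul] at h5
      -- Near p = 0 the reflection formula makes this quantity equal to A > 0, but a bounded S would
      -- force it to tend to 0.
      have h6 : ∀ᶠ n in atTop, ‖studentCont q (v n) + studentCont q (2 - v n)‖ * ‖v n‖ ^ q *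
          ‖2 - v n‖ ^ q = A := by
        filter_upwards [hsecond hre1] with n hn
        have hn0 := slitPlane_ne_zero (hvs n)
        have hn2 := slitPlane_ne_zero (slitPlane_two_sub (by linarith [hn.1] : (v n).re < 2))
        rw [hrefl (v n) (hvs n) (by linarith [hn.1]), sub_add_cancel, norm_mul, norm_real,
          Real.norm_of_nonneg hA.le, norm_exp_log_add_log q hn0 hn2,
          Real.rpow_neg (norm_nonneg _), Real.rpow_neg (norm_nonneg _)]
        have := Real.rpow_pos_of_pos (norm_pos_iff.2 hn0) q
        have := Real.rpow_pos_of_pos (norm_pos_iff.2 hn2) q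
        field_simp
      have := tendsto_nhds_unique (tendsto_const_nhds.congr' (h6.mono fun n hn => hn.symm)) h5
      exact hA.ne' this
    · have hneg : p.re < 0 := lt_of_le_of_ne hps.1 fun h => hp0 (Complex.ext h hps.2)
      have harg : arg p = Real.pi := arg_eq_pi_iff.2 ⟨hneg, hps.2⟩
      have h1 : Tendsto (fun n => |arg (v n)|) atTop (𝓝 Real.pi) := by
        have := (continuousAt_abs_arg hp0).tendsto.comp hp
        simpa [harg, abs_of_pos Real.pi_pos, Function.comp_def] using this
      have h2 : Tendsto (fun n => |arg (2 - v n)|) atTop (𝓝 0) := by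
        have hs := slitPlane_two_sub (by linarith : p.re < 2)
        have h3 : arg (2 - p) = 0 := by
          rw [arg_eq_zero_iff]
          simp [hps.2]
          linarith
        have := ((continuousAt_arg hs).abs.tendsto).comp (hp.const_sub 2)
        simpa [h3, Function.comp_def] using this
      have h3 : ∀ᶠ n in atTop, q * (|arg (v n)| - |arg (2 - v n)|) ≤ Real.pi / 2 := by
        filter_upwards [hsecond hre1] with n hn
        refine le_trans (mul_le_mul_of_nonneg_left ?_ hq0.le) hn.2.le
        rw [argSum]
        have := abs_sub_abs_le_abs_sub (arg (v n)) (-arg (2 - v n))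
        rwa [abs_neg, sub_neg_eq_add] at this
      -- In the limit qπ ≤ π/2, contrary to q > 1/2.
      have h4 := le_of_tendsto ((h1.sub h2).const_mul q) h3
      nlinarith [Real.pi_pos]

/-- Take a large value K = S(t) with t > 0 small. Its preimages are all near 0, where the reflection
formula reads A exp(-qL) = K + S(2-p) with L = log p + log(2-p). The argument condition permits
taking logarithms, so -qL = log((K + S(2-p))/A). The right side has Lipschitz constant O(1/K) in p,
while distances in p are at most twice those in L; for large K two solutions must coincide. -/
theorem exists_simple_fibre_studentCont {q : ℝ} (hq : 1 / 2 < q) :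
    ∃ z₀ ∈ studentReg q, deriv (studentCont q) z₀ ≠ 0 ∧
      ∀ z ∈ studentReg q, studentCont q z = studentCont q z₀ → z = z₀ := by
  have hq0 : 0 < q := by linarith
  obtain ⟨A, C, hA, hC, hrefl, hbd1, hbd⟩ := exists_norm_studentCont_le_slitPlane hq
  obtain ⟨D, hD0, hD⟩ : ∃ D : ℝ, 0 ≤ D ∧ ∀ a ∈ Metric.closedBall (2 : ℂ) (1 / 2),
      ∀ b ∈ Metric.closedBall (2 : ℂ) (1 / 2),
        ‖studentCont q b - studentCont q a‖ ≤ D * ‖b - a‖ := by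
    have hsub : Metric.closedBall (2 : ℂ) (1 / 2) ⊆ slitPlane := by
      intro a ha
      rw [mem_closedBall_iff_norm] at ha
      have := (abs_re_le_norm (a - 2)).trans ha
      rw [abs_le] at this
      left
      simp at this
      linarith
    have hdc : ContinuousOn (deriv (studentCont q)) slitPlane :=
      ((differentiableOn_studentCont hq0).deriv isOpen_slitPlane).continuousOn
    obtain ⟨D, hD⟩ := (isCompact_closedBall (2 : ℂ) (1 / 2)).exists_bound_of_continuousOn
      (hdc.mono hsub)
    refine ⟨max D 0, le_max_right _ _, fun a ha b hb => ?_⟩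
    exact (convex_closedBall (2 : ℂ) (1 / 2)).norm_image_sub_le_of_norm_deriv_le
      (fun x hx => (differentiableOn_studentCont hq0).differentiableAt
        (isOpen_slitPlane.mem_nhds (hsub hx)))
      (fun x hx => (hD x hx).trans (le_max_left _ _)) ha hb
  -- The first two terms force preimages into |p| < 1/2, the next two give 2D/q < K - C for the
  -- contraction, and the last C absorbs S(2-t) when K is compared with A(t(2-t))^(-q).
  obtain ⟨t, ⟨ht0, ht1⟩, htK⟩ : ∃ t : ℝ, (0 < t ∧ t < 1 / 2) ∧
      A * (1 / 2) ^ (-q) + C / (1 / 2) + C + 2 * D / q + C < A * 2 ^ (-q) * t ^ (-q) := by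
    have h1 : Tendsto (fun t : ℝ => A * 2 ^ (-q) * t ^ (-q)) (𝓝[>] 0) atTop := by
      refine Tendsto.const_mul_atTop (by positivity) ?_
      refine ((tendsto_rpow_atTop hq0).comp tendsto_inv_nhdsGT_zero).congr' ?_
      filter_upwards [self_mem_nhdsWithin] with t ht
      rw [Function.comp_apply, Real.inv_rpow (le_of_lt ht), Real.rpow_neg (le_of_lt ht)]
    have h2 : ∀ᶠ t : ℝ in 𝓝[>] 0, 0 < t ∧ t < 1 / 2 :=
      (eventually_mem_nhdsWithin (s := Ioi (0 : ℝ))).and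
        (nhdsWithin_le_nhds (gt_mem_nhds (by norm_num)))
    exact (h2.and (h1.eventually_gt_atTop _)).exists
  obtain ⟨hti, htr⟩ := studentCont_ofReal hq ht0
  set K := (studentCont q t).re with hK
  have hKe : studentCont q t = K := by
    apply Complex.ext <;> simp [hK, hti]
  have hts : (t : ℂ) ∈ slitPlane := Or.inl (by simpa using ht0)
  have hKlow : A * (1 / 2) ^ (-q) + C / (1 / 2) + C + 2 * D / q < K := by
    have e := hrefl t hts (by simp; linarith)
    have h1 : (2 : ℂ) - t ≠ 0 := by
      have : (2 - t : ℝ) ≠ 0 := by linarith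
      exact_mod_cast this
    have h2 := congrArg norm (eq_sub_iff_add_eq.1 e)
    rw [norm_mul, norm_real, Real.norm_of_nonneg hA.le,
      norm_exp_log_add_log q (slitPlane_ne_zero hts) h1, norm_real, Real.norm_of_nonneg ht0.le] at h2
    have h3 : ‖studentCont q t + studentCont q (2 - t)‖ ≤ K + C := by
      refine (norm_add_le _ _).trans (add_le_add ?_ (hbd1 _ (by simp; linarith)))
      rw [hKe, norm_real, Real.norm_of_nonneg htr.le]
    have h4 : ‖(2 : ℂ) - t‖ ≤ 2 := by
      have : (2 : ℂ) - t = ((2 - t : ℝ) : ℂ) := by push_cast; ring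
      rw [this, norm_real, Real.norm_of_nonneg (by linarith)]
      linarith
    have h5 : (2 : ℝ) ^ (-q) ≤ ‖(2 : ℂ) - t‖ ^ (-q) :=
      Real.rpow_le_rpow_of_nonpos (norm_pos_iff.2 h1) h4 (by linarith)
    have h6 : A * 2 ^ (-q) * t ^ (-q) ≤ A * (t ^ (-q) * ‖(2 : ℂ) - t‖ ^ (-q)) := by
      rw [mul_assoc, mul_comm ((2 : ℝ) ^ (-q))]
      gcongr
    linarith
  have hKC : 2 * D / q < K - C := by
    have : 0 ≤ A * (1 / 2 : ℝ) ^ (-q) + C / (1 / 2) := by positivity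
    linarith
  have hKC0 : 0 < K - C := lt_of_le_of_lt (by positivity) hKC
  have hlocal : ∀ p ∈ studentReg q, studentCont q p = studentCont q t →
      p ∈ slitPlane ∧ ‖p‖ < 1 / 2 ∧
      A * exp (-q * (log p + log (2 - p))) = K + studentCont q (2 - p) ∧
      log (exp (-q * (log p + log (2 - p)))) = -q * (log p + log (2 - p)) := by
    intro p hp hpt
    have hps := studentDom_subset_slitPlane q hp.1
    have hsmall : ‖p‖ < 1 / 2 := by
      by_contra hcon
      rw [not_lt] at hcon
      have h1 := hbd p hps
      rw [hpt, hKe, norm_real, Real.norm_of_nonneg htr.le] at h1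
      have h2 : ‖p‖ ^ (-q) ≤ (1 / 2) ^ (-q) :=
        Real.rpow_le_rpow_of_nonpos (by norm_num) hcon (by linarith)
      have h3 : C / ‖p‖ ≤ C / (1 / 2) := by gcongr
      have h4 := mul_le_mul_of_nonneg_left h2 hA.le
      have h5 : 0 ≤ 2 * D / q := by positivity
      linarith
    have hre : p.re < 1 := by linarith [re_le_norm p]
    have harg : q * |argSum p| < Real.pi / 2 := by
      rcases hp.1 with h | h
      · exact absurd (h : 1 < p.re) (not_lt.2 hre.le)
      · exact h.2
    refine ⟨hps, hsmall, ?_, ?_⟩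
    · have := hrefl p hps (by linarith)
      rw [hpt, hKe] at this
      rw [this]
      ring
    · have h1 : |q * argSum p| < Real.pi / 2 := by rwa [abs_mul, abs_of_pos hq0]
      rw [abs_lt] at h1
      apply log_exp <;> rw [im_neg_mul_log_add_log] <;> linarith [Real.pi_pos]
  have htreg : (t : ℂ) ∈ studentReg q := by
    refine ⟨Or.inr ⟨⟨hts, by simp; linarith⟩, ?_⟩, htr⟩
    have h1 : arg (t : ℂ) = 0 := arg_ofReal_of_nonneg ht0.le
    have h2 : arg (2 - (t : ℂ)) = 0 := by
      rw [show (2 : ℂ) - t = ((2 - t : ℝ) : ℂ) by push_cast; ring]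
      exact arg_ofReal_of_nonneg (by linarith)
    simp [argSum, h1, h2, Real.pi_pos]
  refine ⟨t, htreg, ?_, ?_⟩
  -- If S'(t) = 0 the equation gives 2q(t-1)K = 2q-1, impossible since t < 1 and K > 0.
  · intro hd
    have h := studentCont_ode hq0 hts
    rw [hd, hKe] at h
    have h' : (t : ℝ) * (2 - t) * 0 = 2 * q * (t - 1) * K - (2 * q - 1) := by exact_mod_cast h
    have : 0 < 2 * q * (1 - t) * K := by
      have : 0 < 1 - t := by linarith
      positivity
    nlinarith
  · intro p hp hpt
    obtain ⟨hs1, hn1, hy1, hl1⟩ := hlocal p hp hpt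
    obtain ⟨hs2, hn2, hy2, hl2⟩ := hlocal t htreg rfl
    set L₁ := log p + log (2 - p) with hL₁
    set L₂ := log (t : ℂ) + log (2 - t) with hL₂
    have hball : ∀ a : ℂ, ‖a‖ < 1 / 2 → 2 - a ∈ Metric.closedBall (2 : ℂ) (1 / 2) := by
      intro a ha
      rw [mem_closedBall_iff_norm, sub_sub_cancel_left, norm_neg]
      exact ha.le
    have hre2 : ∀ a : ℂ, ‖a‖ < 1 / 2 → ‖studentCont q (2 - a)‖ ≤ C := by
      intro a ha
      refine hbd1 _ ?_
      have := re_le_norm a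
      simp
      linarith
    have hT : ∀ y Φ : ℂ, A * y = K + Φ → ‖Φ‖ ≤ C → (K - C) / A ≤ y.re := by
      intro y Φ hy hΦ
      have h1 := congrArg Complex.re hy
      rw [re_ofReal_mul, add_re, ofReal_re] at h1
      rw [div_le_iff₀ hA]
      have := abs_le.1 ((abs_re_le_norm Φ).trans hΦ)
      linarith
    -- The logarithm is Lipschitz with constant A/(K-C) on the half-plane Re y ≥ (K-C)/A.
    have hlog : ‖-(q : ℂ) * L₁ - -q * L₂‖ ≤
        ((K - C) / A)⁻¹ * ‖exp (-q * L₁) - exp (-q * L₂)‖ := by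
      have hTpos : 0 < (K - C) / A := div_pos hKC0 hA
      have hdl : ∀ y : ℂ, y ∈ {y : ℂ | (K - C) / A ≤ y.re} → y ∈ slitPlane := fun y hy =>
        Or.inl (hTpos.trans_le hy)
      have := (convex_halfSpace_re_ge ((K - C) / A)).norm_image_sub_le_of_norm_deriv_le
        (f := log) (C := ((K - C) / A)⁻¹)
        (fun y hy => (hasDerivAt_log (hdl y hy)).differentiableAt) (fun y hy => by
          rw [(hasDerivAt_log (hdl y hy)).deriv, norm_inv]
          exact inv_anti₀ hTpos (le_trans hy (re_le_norm y)))
        (hT _ _ hy2 (hre2 _ hn2)) (hT _ _ hy1 (hre2 _ hn1))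
      rwa [hl1, hl2] at this
    have hy : ‖exp (-q * L₁) - exp (-q * L₂)‖ ≤ D / A * ‖p - t‖ := by
      have h1 : (A : ℂ) * (exp (-q * L₁) - exp (-q * L₂)) =
          studentCont q (2 - p) - studentCont q (2 - t) := by
        rw [mul_sub, hy1, hy2]; ring
      have h2 := congrArg norm h1
      rw [norm_mul, norm_real, Real.norm_of_nonneg hA.le] at h2
      have h3 := hD _ (hball _ hn2) _ (hball _ hn1)
      rw [← h2, sub_sub_sub_cancel_left, norm_sub_rev (t : ℂ) p] at h3
      rw [div_mul_eq_mul_div, le_div_iff₀ hA]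
      linarith
    have hL : q * ‖L₁ - L₂‖ ≤ D / (K - C) * ‖p - t‖ := by
      rw [← mul_sub, norm_mul, norm_neg, norm_real, Real.norm_of_nonneg hq0.le] at hlog
      refine hlog.trans ((mul_le_mul_of_nonneg_left hy (by positivity)).trans_eq ?_)
      field_simp
    have hexpL : ∀ a : ℂ, a ∈ slitPlane → ‖a‖ < 1 / 2 → exp (log a + log (2 - a)) = a * (2 - a) := by
      intro a ha han
      have := re_le_norm a
      rw [exp_add, exp_log (slitPlane_ne_zero ha),
        exp_log (slitPlane_ne_zero (slitPlane_two_sub (by linarith)))]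
    have hbdL : ∀ a : ℂ, a ∈ slitPlane → ‖a‖ < 1 / 2 →
        log a + log (2 - a) ∈ {x : ℂ | x.re ≤ Real.log 2} := by
      intro a ha han
      rw [mem_ofPred_eq, Real.le_log_iff_exp_le two_pos, ← norm_exp, hexpL a ha han, norm_mul]
      have h1 : ‖2 - a‖ ≤ 2 + ‖a‖ := by simpa using norm_sub_le 2 a
      nlinarith [norm_nonneg a, norm_nonneg (2 - a)]
    -- On |a| < 1/2 one has |a(2-a)| ≤ 2, so the values of L lie in Re x ≤ log 2, where exp is
    -- 2-Lipschitz.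
    have hexp : ‖p * (2 - p) - t * (2 - t)‖ ≤ 2 * ‖L₁ - L₂‖ := by
      rw [← hexpL p hs1 hn1, ← hexpL t hs2 hn2]
      refine (convex_halfSpace_re_le (Real.log 2)).norm_image_sub_le_of_norm_deriv_le (f := exp)
        (fun x _ => differentiableAt_exp) (fun x hx => ?_) (hbdL t hs2 hn2) (hbdL p hs1 hn1)
      rw [Complex.deriv_exp, norm_exp]
      exact (Real.le_log_iff_exp_le two_pos).1 hx
    have hpt2 : ‖p - t‖ ≤ 2 * ‖L₁ - L₂‖ := by
      have e : p * (2 - p) - t * (2 - t) = (p - t) * (2 - (p + t)) := by ring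
      rw [e, norm_mul] at hexp
      have h1 : 1 ≤ ‖2 - (p + t)‖ := by
        have h2 := norm_sub_norm_le 2 (p + t)
        have h3 := norm_add_le p t
        simp only [norm_ofNat] at h2
        linarith
      nlinarith [norm_nonneg (p - t)]
    have hfin : ‖p - t‖ = 0 := by
      by_contra hne
      have hpos : 0 < ‖p - t‖ := lt_of_le_of_ne (norm_nonneg _) (Ne.symm hne)
      have h1 : q * ‖p - t‖ ≤ 2 * (D / (K - C) * ‖p - t‖) := by nlinarith
      have h2 : q ≤ 2 * (D / (K - C)) := by
        by_contra hcon
        nlinarith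
      rw [← mul_div_assoc, le_div_iff₀ hKC0] at h2
      rw [div_lt_iff₀ hq0] at hKC
      linarith
    exact sub_eq_zero.1 (norm_eq_zero.1 hfin)

/-- The continued transform maps `studentReg` biholomorphically onto the right half-plane. -/
theorem bijOn_studentCont {q : ℝ} (hq : 1 / 2 < q) :
    BijOn (studentCont q) (studentReg q) right ∧
      ∀ z ∈ studentReg q, deriv (studentCont q) z ≠ 0 := by
  have hq0 : 0 < q := by linarith
  have hsub : studentReg q ⊆ slitPlane := fun p hp => studentDom_subset_slitPlane q hp.1
  obtain ⟨z₀, hz₀, hd, hu⟩ := exists_simple_fibre_studentCont hq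
  exact bijOn_of_proper (isOpen_studentReg hq0) (convex_halfSpace_re_gt 0).isPreconnected
    ((differentiableOn_studentCont hq0).mono hsub) (fun p hp => hp.2)
    (fun z hz => not_eventually_studentCont_eq hq (hsub hz))
    (fun w hw u hu hlim => studentCont_proper hq hw hu hlim) hz₀ hd hu

end FreeUI

/-! ### Symmetry and the continuation of F -/

namespace FreeUI
open Filter Topology Complex

theorem mem_studentReg_of_one_lt_re {q : ℝ} (hq : 1 / 2 < q) {p : ℂ} (hp : 1 < p.re) :
    p ∈ studentReg q :=
  ⟨Or.inl hp, re_studentCont_pos hq hp⟩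

theorem conj_mem_studentReg {q : ℝ} {p : ℂ} (hp : p ∈ studentReg q) :
    (starRingEnd ℂ) p ∈ studentReg q := by
  have hps := studentDom_subset_slitPlane q hp.1
  refine ⟨?_, ?_⟩
  · rcases hp.1 with h | ⟨⟨h1, h2⟩, h3⟩
    · exact Or.inl (by simpa using h)
    · refine Or.inr ⟨⟨?_, by simpa using h2⟩, ?_⟩
      · rw [mem_slitPlane_iff] at h1 ⊢
        simpa using h1
      · have e1 : arg ((starRingEnd ℂ) p) = -arg p := by
          rw [arg_conj, if_neg (mem_slitPlane_iff_arg.1 h1).1]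
        have e2 : arg (2 - (starRingEnd ℂ) p) = -arg (2 - p) := by
          rw [show 2 - (starRingEnd ℂ) p = (starRingEnd ℂ) (2 - p) by
            rw [map_sub, map_ofNat], arg_conj,
            if_neg (mem_slitPlane_iff_arg.1 (slitPlane_two_sub h2)).1]
        rw [mem_ofPred_eq, argSum, e1, e2, ← neg_add, abs_neg]
        exact h3
  · rw [studentCont_conj q hps, conj_re]
    exact hp.2

theorem ofReal_mem_studentReg {q : ℝ} (hq : 1 / 2 < q) {x : ℝ} (hx : 0 < x) :
    (x : ℂ) ∈ studentReg q := by
  rcases lt_or_ge 1 x with h | h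
  · exact mem_studentReg_of_one_lt_re hq (by simpa using h)
  · refine ⟨Or.inr ⟨⟨Or.inl (by simpa using hx), by simp; linarith⟩, ?_⟩,
      (studentCont_ofReal hq hx).2⟩
    have h1 : arg (x : ℂ) = 0 := arg_ofReal_of_nonneg hx.le
    have h2 : arg (2 - (x : ℂ)) = 0 := by
      rw [show (2 : ℂ) - x = ((2 - x : ℝ) : ℂ) by push_cast; ring]
      exact arg_ofReal_of_nonneg (by linarith)
    simp [argSum, h1, h2, Real.pi_pos]

/-- S commutes with conjugation and is injective on the conjugation-invariant set `studentReg`, so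
S(p) is fixed by conjugation exactly when p is. -/
theorem im_studentCont_eq_zero_iff {q : ℝ} (hq : 1 / 2 < q) {p : ℂ} (hp : p ∈ studentReg q) :
    (studentCont q p).im = 0 ↔ p.im = 0 := by
  have hps := studentDom_subset_slitPlane q hp.1
  rw [← conj_eq_iff_im, ← conj_eq_iff_im, ← studentCont_conj q hps]
  exact ⟨fun h => (bijOn_studentCont hq).1.injOn (conj_mem_studentReg hp) hp h, fun h => by rw [h]⟩

/-- The continuation of `F_μ` for the Student distribution. -/
noncomputable def studentF (q : ℝ) (z : ℂ) : ℂ := I / studentCont q (1 - I * z)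

/-- The domain on which the continuation of `F_μ` is univalent. -/
def studentUniv (q : ℝ) : Set ℂ := {z | 1 - I * z ∈ studentReg q}

theorem recipCauchy_studentT {q : ℝ} (hq : 1 / 2 < q) {z : ℂ} (hz : z ∈ upper) :
    recipCauchy (studentT q) z = studentF q z := by
  rw [recipCauchy, cauchyTransform_eq_studentCont hq hz, studentF, one_div, mul_inv, inv_neg, inv_I,
    neg_neg, div_eq_mul_inv]

theorem upper_subset_studentUniv {q : ℝ} (hq : 1 / 2 < q) : upper ⊆ studentUniv q := fun z hz =>
  mem_studentReg_of_one_lt_re hq (by simpa [upper] using hz)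

theorem isOpen_studentUniv {q : ℝ} (hq : 0 < q) : IsOpen (studentUniv q) :=
  (isOpen_studentReg hq).preimage (by fun_prop : Continuous fun z : ℂ => 1 - I * z)

theorem studentCont_ne_zero {q : ℝ} {p : ℂ} (hp : p ∈ studentReg q) : studentCont q p ≠ 0 := by
  intro h
  have := hp.2
  rw [h] at this
  exact lt_irrefl _ this

theorem injOn_studentF {q : ℝ} (hq : 1 / 2 < q) : InjOn (studentF q) (studentUniv q) := by
  intro a ha b hb hab
  have h0 := studentCont_ne_zero ha
  have h1 := studentCont_ne_zero hb
  rw [studentF, studentF, div_eq_div_iff h0 h1] at hab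
  have h2 := (bijOn_studentCont hq).1.injOn hb ha (mul_left_cancel₀ I_ne_zero hab)
  exact (mul_left_cancel₀ I_ne_zero (sub_right_injective h2)).symm

theorem differentiableOn_studentF {q : ℝ} (hq : 0 < q) :
    DifferentiableOn ℂ (studentF q) (studentUniv q) := by
  refine DifferentiableOn.fun_div (differentiableOn_const _) ?_ fun z hz => studentCont_ne_zero hz
  refine (differentiableOn_studentCont hq).comp (t := slitPlane) (f := fun z : ℂ => 1 - I * z)
    (by fun_prop) fun z hz => ?_
  exact studentDom_subset_slitPlane q (hz : 1 - I * z ∈ studentReg q).1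

theorem re_I_div (w : ℂ) : (I / w).re = w.im / normSq w := by
  simp [div_eq_mul_inv, inv_im]

theorem im_I_div (w : ℂ) : (I / w).im = w.re / normSq w := by
  simp [div_eq_mul_inv, inv_re]

theorem I_div_I_div (w : ℂ) : I / (I / w) = w := by
  rw [div_div_eq_mul_div, mul_div_cancel_left₀ _ I_ne_zero]

/-! ### Behaviour near infinity -/

/-- Nontangential asymptotics of the Cauchy transform of a probability measure. -/
theorem exists_norm_mul_cauchyTransform_sub_one_le (μ : Measure ℝ) [IsProbabilityMeasure μ]
    (l : ℝ) {ε : ℝ} (hε : 0 < ε) :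
    ∃ M : ℝ, 0 < M ∧ ∀ u ∈ cone l M, ‖u * cauchyTransform μ u - 1‖ ≤ ε := by
  have hne : ∀ u : ℂ, 0 < u.im → ∀ x : ℝ, u - x ≠ 0 := fun u hu x => sub_ofReal_ne_zero hu x
  -- In the cone ‖u‖ ≤ (l+1) Im u, and Im u ≤ ‖u - x‖; this gives a constant dominating function for
  -- u G(u) - 1 = ∫ x/(u-x) μ(dx).
  have hxle : ∀ u ∈ cone l 0, ∀ x : ℝ, ‖(x : ℂ) / (u - x)‖ ≤ l + 2 := by
    intro u hu x
    have hi : 0 < u.im := hu.1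
    have h1 := im_le_norm_sub_ofReal u x
    have h2 : ‖u‖ ≤ |u.re| + |u.im| := norm_le_abs_re_add_abs_im u
    have h3 : ‖(x : ℂ)‖ ≤ ‖u‖ + ‖u - x‖ := by
      have := norm_sub_le u (u - x)
      rwa [sub_sub_cancel] at this
    have h4 := hu.2.2
    have hl : 0 < l := by
      have := (abs_nonneg u.re).trans_lt h4
      exact pos_of_mul_pos_left this hi.le
    rw [abs_of_pos hi] at h2
    rw [norm_div, div_le_iff₀ (norm_pos_iff.2 (hne u hi x))]
    nlinarith
  have hmeas : ∀ u ∈ cone l 0, AEStronglyMeasurable (fun x : ℝ => (x : ℂ) / (u - x)) μ := by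
    intro u hu
    refine Continuous.aestronglyMeasurable ?_
    exact continuous_ofReal.div (by fun_prop) fun x => hne u hu.1 x
  set L : Filter ℂ := comap Complex.im atTop ⊓ 𝓟 (cone l 0) with hL
  have hLc : ∀ᶠ u in L, u ∈ cone l 0 := eventually_inf_principal.2 (Eventually.of_forall fun _ h => h)
  have hLim : Tendsto Complex.im L atTop := tendsto_comap.mono_left inf_le_left
  have hlim : Tendsto (fun u : ℂ => ∫ x : ℝ, (x : ℂ) / (u - x) ∂μ) L (𝓝 (∫ x : ℝ, (0 : ℂ) ∂μ)) := by
    refine tendsto_integral_filter_of_dominated_convergence (fun _ => l + 2) ?_ ?_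
      (integrable_const _) ?_
    · exact hLc.mono hmeas
    · exact hLc.mono fun u hu => Eventually.of_forall (hxle u hu)
    · refine Eventually.of_forall fun x => ?_
      have h1 : Tendsto (fun u : ℂ => |x| / u.im) L (𝓝 0) := tendsto_const_nhds.div_atTop hLim
      refine squeeze_zero_norm' ?_ h1
      filter_upwards [hLc] with u hu
      rw [norm_div, norm_real, Real.norm_eq_abs]
      have := im_le_norm_sub_ofReal u x
      have hi : 0 < u.im := hu.1
      gcongr
  rw [integral_zero] at hlim
  have hev : ∀ᶠ u in L, ‖∫ x : ℝ, (x : ℂ) / (u - x) ∂μ‖ ≤ ε :=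
    hlim.norm.eventually (ge_mem_nhds (by simpa using hε))
  rw [hL, eventually_inf_principal, eventually_comap] at hev
  obtain ⟨M, hM⟩ := eventually_atTop.1 hev
  refine ⟨max M 1, by positivity, fun u hu => ?_⟩
  have huM : M ≤ u.im := (le_max_left _ _).trans hu.2.1.le
  have huc : u ∈ cone l 0 := ⟨hu.1, hu.1, hu.2.2⟩
  have hb := hM u.im huM u rfl huc
  have hint : Integrable (fun x : ℝ => (x : ℂ) / (u - x)) μ :=
    Integrable.of_bound (hmeas u huc) (l + 2) (Eventually.of_forall (hxle u huc))
  have e : u * cauchyTransform μ u - 1 = ∫ x : ℝ, (x : ℂ) / (u - x) ∂μ := by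
    have h1 : u * cauchyTransform μ u = ∫ x : ℝ, ((x : ℂ) / (u - x) + 1) ∂μ := by
      rw [cauchyTransform, ← integral_const_mul]
      refine integral_congr_ae (Eventually.of_forall fun x => ?_)
      have := hne u hu.1 x
      simp only
      field_simp
      ring
    rw [h1, integral_add hint (integrable_const _)]
    simp
  rw [e]
  exact hb

/-- If `F_μ` is univalent on `ℂ⁺` then it covers a cone near infinity. -/
theorem exists_cone_subset_image_recipCauchy (μ : Measure ℝ) [IsProbabilityMeasure μ]
    (hd : DifferentiableOn ℂ (recipCauchy μ) upper) (hinj : InjOn (recipCauchy μ) upper) :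
    ∃ M M' : ℝ, 0 < M ∧ 0 < M' ∧ cone 1 M ⊆ recipCauchy μ '' cone 2 M' := by
  -- The tolerance 1/100 gives |F(u) - u| ≤ ‖z‖/40 on the closed ball of radius ‖z‖/8 about z, which
  -- lies in the wider cone.
  obtain ⟨M', hM', hbd⟩ := exists_norm_mul_cauchyTransform_sub_one_le μ 2
    (by norm_num : (0 : ℝ) < 1 / 100)
  refine ⟨2 * M', M', by positivity, hM', fun z hz => ?_⟩
  have hzi : 2 * M' < z.im := hz.2.1
  have hzi0 : 0 < z.im := hz.1
  have hzr : |z.re| < z.im := by simpa using hz.2.2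
  have hzn : ‖z‖ < 2 * z.im := by
    have := norm_le_abs_re_add_abs_im z
    rw [abs_of_pos hzi0] at this
    linarith
  have hz0 : 0 < ‖z‖ := hzi0.trans_le (im_le_norm z)
  have hball : Metric.closedBall z (‖z‖ / 8) ⊆ cone 2 M' := by
    intro u hu
    rw [mem_closedBall_iff_norm] at hu
    have h1 := (abs_im_le_norm (u - z)).trans hu
    have h2 := (abs_re_le_norm (u - z)).trans hu
    rw [sub_im, abs_le] at h1
    rw [sub_re, abs_le] at h2
    rw [abs_lt] at hzr
    refine ⟨?_, ?_, ?_⟩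
    · show 0 < u.im
      linarith
    · linarith
    · rw [abs_lt]
      constructor <;> linarith
  have hF : ∀ u ∈ Metric.closedBall z (‖z‖ / 8), ‖recipCauchy μ u - u‖ ≤ ‖z‖ / 40 := by
    intro u hu
    have h1 := hbd u (hball hu)
    set a := u * cauchyTransform μ u with ha
    have hu0 : u ≠ 0 := by
      rintro rfl
      have := (hball hu).1
      simp [upper] at this
    have han : 99 / 100 ≤ ‖a‖ := by
      have := norm_sub_norm_le (1 : ℂ) (1 - a)
      rw [norm_sub_rev 1 a, sub_sub_cancel, norm_one] at this
      linarith
    have ha0 : a ≠ 0 := norm_pos_iff.1 (by linarith)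
    have e : recipCauchy μ u - u = u * (1 - a) / a := by
      have : cauchyTransform μ u = a / u := by rw [ha]; field_simp
      rw [recipCauchy, this]
      field_simp
    have hun : ‖u‖ ≤ 9 / 8 * ‖z‖ := by
      rw [mem_closedBall_iff_norm] at hu
      have := norm_le_norm_add_norm_sub' u z
      linarith
    rw [e, norm_div, norm_mul, norm_sub_rev, div_le_iff₀ (by linarith)]
    nlinarith [norm_nonneg (a - 1), norm_nonneg u]
  have hzmem : z ∈ Metric.closedBall z (‖z‖ / 8) := Metric.mem_closedBall_self (by positivity)
  have hsub : Metric.closedBall z (‖z‖ / 8) ⊆ upper := fun u hu => (hball hu).1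
  have hcl : DiffContOnCl ℂ (recipCauchy μ) (Metric.ball z (‖z‖ / 8)) := by
    refine DifferentiableOn.diffContOnCl ?_
    rw [closure_ball _ (by positivity)]
    exact hd.mono hsub
  -- On the sphere |F(u) - F(z)| ≥ ‖z‖/8 - 2‖z‖/40 = 3‖z‖/40. The quantitative open mapping theorem
  -- then covers the ball of radius 3‖z‖/80 about F(z), which contains z because |F(z) - z| ≤
  -- ‖z‖/40.
  have himg := hcl.ball_subset_image_closedBall (ε := 3 / 40 * ‖z‖) (by positivity) ?_ ?_
  · have hmem : z ∈ Metric.ball (recipCauchy μ z) (3 / 40 * ‖z‖ / 2) := by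
      rw [mem_ball_iff_norm, norm_sub_rev]
      have := hF z hzmem
      linarith
    obtain ⟨u, hu, e⟩ := himg hmem
    exact ⟨u, hball hu, e⟩
  · intro u hu
    have h1 := hF u (Metric.sphere_subset_closedBall hu)
    have h2 := hF z hzmem
    rw [mem_sphere_iff_norm] at hu
    have e : u - z = (recipCauchy μ u - recipCauchy μ z) - (recipCauchy μ u - u) +
      (recipCauchy μ z - z) := by ring
    have h3 : ‖u - z‖ ≤ ‖recipCauchy μ u - recipCauchy μ z‖ + ‖recipCauchy μ u - u‖ +
        ‖recipCauchy μ z - z‖ := by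
      conv_lhs => rw [e]
      exact (norm_add_le _ _).trans (add_le_add_left (norm_sub_le _ _) _)
    linarith
  · have hup : upper ∈ 𝓝 z := (isOpen_lt continuous_const continuous_im).mem_nhds hz.1
    have h1 : ∀ᶠ u in 𝓝[≠] z, recipCauchy μ u ≠ recipCauchy μ z := by
      filter_upwards [self_mem_nhdsWithin, nhdsWithin_le_nhds hup] with u hu1 hu2 h
      exact hu1 (hinj hu2 hz.1 h)
    exact h1.frequently.filter_mono nhdsWithin_le_nhds

/-! ### Membership in the two classes -/

theorem classUI_studentT {q : ℝ} (hq : 1 / 2 < q) : ClassUI (studentT q) := by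
  have hq0 : 0 < q := by linarith
  have hprob := isProbabilityMeasure_studentT hq
  obtain ⟨hbij, hder⟩ := bijOn_studentCont hq
  set k := Function.invFunOn (studentCont q) (studentReg q) with hk
  have hkmem : MapsTo k right (studentReg q) := hbij.surjOn.mapsTo_invFunOn
  have hkval : ∀ w ∈ right, studentCont q (k w) = w := fun w hw => hbij.surjOn.rightInvOn_invFunOn hw
  have hkd : DifferentiableOn ℂ k right := by
    refine differentiableOn_of_rightInvOn (isOpen_studentReg hq0)
      ((differentiableOn_studentCont hq0).mono fun p hp => studentDom_subset_slitPlane q hp.1)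
      hbij.injOn hder hkmem hkval (isOpen_lt continuous_const continuous_re)
  have hright : MapsTo (fun z => I / z) upper right := by
    intro z hz
    have hz' : 0 < z.im := hz
    show 0 < (I / z).re
    rw [re_I_div]
    refine div_pos hz' (normSq_pos.2 ?_)
    rintro rfl
    simp at hz'
  have hF : EqOn (recipCauchy (studentT q)) (studentF q) upper := fun z hz =>
    recipCauchy_studentT hq hz
  have hFd : DifferentiableOn ℂ (recipCauchy (studentT q)) upper :=
    ((differentiableOn_studentF hq0).mono (upper_subset_studentUniv hq)).congr hF
  have hFi : InjOn (recipCauchy (studentT q)) upper :=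
    ((injOn_studentF hq).mono (upper_subset_studentUniv hq)).congr hF.symm
  obtain ⟨M, M', hM, hM', hcover⟩ := exists_cone_subset_image_recipCauchy (studentT q) hFd hFi
  -- Solving i/S(1-iz') = z for z', with k the inverse of S, gives z' = i(k(i/z) - 1).
  refine ⟨hprob, 1, M, one_pos, hM, fun z => I * (k (I / z) - 1), ⟨2, M', two_pos, hM',
    hFi.mono fun z hz => hz.1, fun z hz => ?_⟩, ?_, ?_⟩
  · obtain ⟨u, hu, rfl⟩ := hcover hz
    have hreg := upper_subset_studentUniv hq hu.1
    have hIz : I / recipCauchy (studentT q) u = studentCont q (1 - I * u) := by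
      rw [hF hu.1, studentF, I_div_I_div]
    have hkk : k (I / recipCauchy (studentT q) u) = 1 - I * u := by
      rw [hIz]
      exact hbij.injOn (hkmem hreg.2) hreg (hkval _ hreg.2)
    have e : I * (k (I / recipCauchy (studentT q) u) - 1) = u := by
      rw [hkk]
      linear_combination -u * I_sq
    simp only [e]
    exact ⟨hu, trivial⟩
  · have h1 : DifferentiableOn ℂ (fun z => I / z) upper := by
      refine DifferentiableOn.fun_div (differentiableOn_const _) differentiableOn_id ?_
      rintro z hz rfl
      simp [upper] at hz
    exact ((hkd.comp h1 hright).sub_const 1).const_mul I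
  · intro a ha b hb hab
    have h1 := sub_left_injective (mul_left_cancel₀ I_ne_zero hab)
    have h2 := congrArg (studentCont q) h1
    rw [hkval _ (hright ha), hkval _ (hright hb)] at h2
    have h3 : I / a = I / b := h2
    rw [← I_div_I_div a, h3, I_div_I_div]

/-- On the open first quadrant the inverse of S never takes real values, and the quadrant is
connected, so its imaginary part has constant sign. One test point determines that sign. -/
theorem im_neg_of_im_studentCont_pos {q : ℝ} (hq : 1 / 2 < q) {p : ℂ} (hp : p ∈ studentReg q)
    (hpos : 0 < (studentCont q p).im) : p.im < 0 := by
  have hq0 : 0 < q := by linarith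
  have hprob := isProbabilityMeasure_studentT hq
  obtain ⟨hbij, hder⟩ := bijOn_studentCont hq
  set k := Function.invFunOn (studentCont q) (studentReg q) with hk
  have hkmem : MapsTo k right (studentReg q) := hbij.surjOn.mapsTo_invFunOn
  have hkval : ∀ w ∈ right, studentCont q (k w) = w := fun w hw => hbij.surjOn.rightInvOn_invFunOn hw
  have hkinv : ∀ p ∈ studentReg q, k (studentCont q p) = p := fun p hp =>
    hbij.injOn (hkmem hp.2) hp (hkval _ hp.2)
  have hkd : DifferentiableOn ℂ k right := by
    refine differentiableOn_of_rightInvOn (isOpen_studentReg hq0)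
      ((differentiableOn_studentCont hq0).mono fun p hp => studentDom_subset_slitPlane q hp.1)
      hbij.injOn hder hkmem hkval (isOpen_lt continuous_const continuous_re)
  set Q : Set ℂ := right ∩ {w | 0 < w.im} with hQ
  have hQc : IsPreconnected Q :=
    ((convex_halfSpace_re_gt 0).inter (convex_halfSpace_im_gt 0)).isPreconnected
  have hcont : ContinuousOn (fun w => (k w).im) Q :=
    continuous_im.comp_continuousOn (hkd.continuousOn.mono inter_subset_left)
  have hne : ∀ w ∈ Q, (k w).im ≠ 0 := by
    intro w hw h
    have h1 := (im_studentCont_eq_zero_iff hq (hkmem hw.1)).2 h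
    rw [hkval w hw.1] at h1
    have : 0 < w.im := hw.2
    linarith
  obtain ⟨M, hM, hbd⟩ := exists_norm_mul_cauchyTransform_sub_one_le (studentT q) 2
    (by norm_num : (0 : ℝ) < 1 / 100)
  set R := M + 1 with hR
  have hR0 : 0 < R := by linarith
  -- For this u, p₁ = 1 - iu has imaginary part -R, and S(p₁) is close to i/u = (1+i)/(2R), which
  -- has positive imaginary part.
  set u : ℂ := R * (1 + I) with hu
  have hure : u.re = R := by simp [hu]
  have huim : u.im = R := by simp [hu]
  have hucone : u ∈ cone 2 M := by
    refine ⟨by simpa [upper, huim] using hR0, by rw [huim]; linarith, ?_⟩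
    rw [hure, huim, abs_of_pos hR0]
    linarith
  have hureg := upper_subset_studentUniv hq hucone.1
  have hb := hbd u hucone
  rw [cauchyTransform_eq_studentCont hq hucone.1] at hb
  set p₁ := 1 - I * u with hp₁
  have hp₁im : p₁.im = -R := by simp [hp₁, hure]
  set s := studentCont q p₁ with hs
  have hs1 : 0 < s.im := by
    have h1 := (abs_re_le_norm _).trans hb
    have h2 := (abs_im_le_norm _).trans hb
    rw [abs_le] at h1 h2
    simp [hure, huim] at h1 h2
    have h3 : 0 < R * s.im * 2 := by linarith
    have h4 : 0 < R * s.im := by linarith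
    exact pos_of_mul_pos_right h4 hR0.le
  have hneg₁ : (k s).im < 0 := by
    rw [hkinv p₁ hureg, hp₁im]
    linarith
  by_contra hcon
  have hcon' : 0 ≤ (k (studentCont q p)).im := by
    rw [hkinv p hp]
    exact not_lt.1 hcon
  obtain ⟨w, hw, hw0⟩ := hQc.intermediate_value (a := s) (b := studentCont q p)
    ⟨hureg.2, hs1⟩ ⟨hp.2, hpos⟩ hcont ⟨hneg₁.le, hcon'⟩
  exact hne w hw hw0

theorem classUIs_studentT {q : ℝ} (hq : 1 / 2 < q) : ClassUIs (studentT q) := by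
  have hq0 : 0 < q := by linarith
  obtain ⟨hbij, -⟩ := bijOn_studentCont hq
  have hdiff := differentiableOn_studentF hq0
  have hext : ∀ U : Set ℂ, ExtendsRecipCauchy (studentT q) (studentF q) U := fun U z hz =>
    (recipCauchy_studentT hq hz.2).symm
  -- The point z = iy corresponds to p = 1+y, which is positive exactly for y > -1; hence c = -1.
  -- The domain Ω is cut out by Im S > 0 because F = i/S has real part Im S/|S|².
  refine ⟨isProbabilityMeasure_studentT hq, isNegInvariant_studentT q,
    ⟨-1, by norm_num, studentUniv q, studentF q, isOpen_studentUniv hq0, ?_,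
      ⟨hdiff, injOn_studentF hq⟩, hext _, ?_⟩,
    ⟨studentUniv q ∩ {z | 0 < (studentCont q (1 - I * z)).im}, studentF q, ?_, ?_, ?_,
      hdiff.mono inter_subset_left, hext _, ?_, ?_, ?_⟩⟩
  · rintro z ⟨y, hy, rfl⟩
    show 1 - I * (y * I) ∈ studentReg q
    rw [show 1 - I * (y * I) = ((1 + y : ℝ) : ℂ) by push_cast; linear_combination -(y : ℂ) * I_sq]
    exact ofReal_mem_studentReg hq (by linarith)
  · ext w
    constructor
    · rintro ⟨z, ⟨y, hy, rfl⟩, rfl⟩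
      have hy1 : 0 < 1 + y := by linarith
      obtain ⟨hi, hr⟩ := studentCont_ofReal hq hy1
      refine ⟨((studentCont q ((1 + y : ℝ) : ℂ)).re)⁻¹, inv_pos.2 hr, ?_⟩
      rw [studentF, show 1 - I * (y * I) = ((1 + y : ℝ) : ℂ) by
        push_cast; linear_combination -(y : ℂ) * I_sq]
      have e : studentCont q ((1 + y : ℝ) : ℂ) = ((studentCont q ((1 + y : ℝ) : ℂ)).re : ℂ) :=
        Complex.ext (by rw [ofReal_re]) (by rw [hi, ofReal_im])
      rw [e, ofReal_re, ofReal_inv, div_eq_mul_inv, mul_comm]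
    · rintro ⟨y, hy, rfl⟩
      have hmem : ((y⁻¹ : ℝ) : ℂ) ∈ right := by
        show 0 < ((y⁻¹ : ℝ) : ℂ).re
        rw [ofReal_re]
        exact inv_pos.2 hy
      obtain ⟨p, hp, e⟩ := hbij.surjOn hmem
      have him : p.im = 0 := (im_studentCont_eq_zero_iff hq hp).1 (by rw [e, ofReal_im])
      have hpos : 0 < p.re := by
        have := studentDom_subset_slitPlane q hp.1
        rw [mem_slitPlane_iff] at this
        exact this.resolve_right (by simpa using him)
      have hpe : p = (p.re : ℂ) := Complex.ext (by rw [ofReal_re]) (by rw [him, ofReal_im])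
      refine ⟨((p.re - 1 : ℝ) : ℂ) * I, ⟨p.re - 1, by linarith, rfl⟩, ?_⟩
      rw [studentF, show 1 - I * (((p.re - 1 : ℝ) : ℂ) * I) = p by
        conv_rhs => rw [hpe]
        push_cast; linear_combination -((p.re : ℂ) - 1) * I_sq, e, ofReal_inv, div_inv_eq_mul,
        mul_comm]
  · have hc : ContinuousOn (fun z => (studentCont q (1 - I * z)).im) (studentUniv q) := by
      refine continuous_im.comp_continuousOn ((continuousOn_studentCont hq0).comp (t := slitPlane)
        (f := fun z : ℂ => 1 - I * z) (by fun_prop) fun z hz => ?_)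
      exact studentDom_subset_slitPlane q (hz : 1 - I * z ∈ studentReg q).1
    exact hc.isOpen_inter_preimage (isOpen_studentUniv hq0) isOpen_Ioi
  · rintro z ⟨hz, hpos⟩
    right
    have := im_neg_of_im_studentCont_pos hq hz hpos
    show 0 < z.re
    simpa using this
  · intro l M hl hM
    set y := M + 1 with hy
    have hy0 : 0 < y := by linarith
    have hδ : 0 < l * y / 2 := by positivity
    set z : ℂ := ⟨l * y / 2, y⟩ with hz
    have hup : z ∈ upper := hy0
    have hzU := upper_subset_studentUniv hq hup
    have him : (1 - I * z).im = -(l * y / 2) := by simp [hz]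
    refine ⟨z, ⟨hzU, ?_⟩, hup, by simp [hz, hy], ?_⟩
    · show 0 < (studentCont q (1 - I * z)).im
      by_contra hcon
      have hne : (studentCont q (1 - I * z)).im ≠ 0 := fun h => by
        rw [im_studentCont_eq_zero_iff hq hzU, him] at h
        linarith
      have hlt := lt_of_le_of_ne (not_lt.1 hcon) hne
      -- If Im S were negative at p = 1 - iz, it would be positive at the conjugate of p, whose
      -- imaginary part ly/2 is positive.
      have := im_neg_of_im_studentCont_pos hq (conj_mem_studentReg hzU) (by
        rw [studentCont_conj q (studentDom_subset_slitPlane q hzU.1), conj_im]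
        linarith)
      rw [conj_im, him] at this
      linarith
    · show |l * y / 2| < l * y
      rw [abs_of_pos hδ]
      linarith
  · rintro z ⟨hz, hpos⟩
    have hn := normSq_pos.2 (studentCont_ne_zero hz)
    refine ⟨?_, ?_⟩
    · show 0 < (I / studentCont q (1 - I * z)).im
      rw [im_I_div]
      exact div_pos hz.2 hn
    · show 0 < (I / studentCont q (1 - I * z)).re
      rw [re_I_div]
      exact div_pos hpos hn
  · exact (injOn_studentF hq).mono inter_subset_left
  · rintro w ⟨hw1, hw2⟩
    have hw1' : 0 < w.im := hw1
    have hw2' : 0 < w.re := hw2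
    have hn : 0 < normSq w := normSq_pos.2 (by rintro rfl; simp at hw1')
    have hmem : I / w ∈ right := by
      show 0 < (I / w).re
      rw [re_I_div]
      exact div_pos hw1' hn
    obtain ⟨p, hp, e⟩ := hbij.surjOn hmem
    have hp1 : 1 - I * (I * (p - 1)) = p := by linear_combination -(p - 1) * I_sq
    refine ⟨I * (p - 1), ⟨?_, ?_⟩, ?_⟩
    · show 1 - I * (I * (p - 1)) ∈ studentReg q
      rwa [hp1]
    · show 0 < (studentCont q (1 - I * (I * (p - 1)))).im
      rw [hp1, e, im_I_div]
      exact div_pos hw2' hn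
    · rw [studentF, hp1, e, I_div_I_div]

end FreeUI

theorem theorem5p5 :
    (∀ q : ℝ,
      q ∈ Set.Ioc (1 / 2 : ℝ) 2 ∪
          ⋃ (n : ℕ) (_ : 1 ≤ n), Set.Icc (2 * (n : ℝ) + 1 / 2) (2 * (n : ℝ) + 2) →
        FreeUI.ClassUI (FreeUI.studentT q)) ∧
    (∀ q : ℝ,
      q ∈ Set.Ioc (1 / 2 : ℝ) 1 ∪
          ⋃ (n : ℕ) (_ : 1 ≤ n), Set.Icc ((n : ℝ) + 1 / 4) ((n : ℝ) + 1) →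
        FreeUI.ClassUIs (FreeUI.studentT q)) := by
  refine ⟨fun q hq => FreeUI.classUI_studentT ?_, fun q hq => FreeUI.classUIs_studentT ?_⟩
  all_goals
    rcases hq with h | h
    · exact h.1
    · simp only [Set.mem_iUnion] at h
      obtain ⟨n, hn, h⟩ := h
      have hn' : (1 : ℝ) ≤ n := by exact_mod_cast hn
      have := h.1
      linarith
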